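/- For complex $a$ put $(a)_n=a(a+1)\cdots(a+n-1)$, and let ${}_rF_q(a_1,\dots,a_r;b_1,\dots,b_q;x)=\sum_{n\ge 0}\frac{(a_1)_n\cdots(a_r)_n}{(b_1)_n\cdots(b_q)_n}\frac{x^n}{n!}$. Let $1/\Gamma$ denote the entire reciprocal Gamma function, and for complex $\nu$ let $$H_\nu(x)=\frac{2^\nu\sqrt\pi}{\Gamma(\frac12-\frac\nu2)}\,{}_1F_1\!\left(-\tfrac\nu2;\tfrac12;x^2\right)-\frac{2^{\nu+1}\sqrt\pi}{\Gamma(-\frac\nu2)}\,x\,{}_1F_1\!\left(\tfrac12-\tfrac\nu2;\tfrac32;x^2\right)$$ be the Hermite function. Consider the biconfluent Heun equation $$z\Phi''+(p_0+p_1sz-2s^2z^2)\Phi'+(q_0s+q_1s^2z)\Phi=0\qquad(\ast)$$ with complex parameters. Let $N\ge 0$ be an integer, suppose $p_0=-N$, and put $\beta=p_0+q_1/2$, $\xi=sz-p_1/2$, $N'=\lfloor N/2\rfloor$, $N''=\lfloor (N-1)/2\rfloor$ (sums up to $N''$ are empty if $N=0$). Let $M=(M_{ij})_{0\le i,j\le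 N}$ be the tridiagonal matrix with $$M_{i,i}=(i-N)p_1,\qquad M_{i,i+1}=(i+1)\bigl(2(i+1-N)+q_1\bigr),\qquad M_{i+1,i}=i-N,$$ and suppose that $q_0$ is an eigenvalue of $M$. Let $(d_0,\dots,d_N)$ be any eigenvector of $M$ for $q_0$, and put $d_n=0$ for $n>N$. **(a)** The function $\Phi(z)=\sum_{n=0}^N d_nH_{\beta+n}(\xi)$ is an entire solution of $(\ast)$, and it is not identically zero if $s\ne0$. **(b)** Suppose in addition that $\beta+n\neq 0$ for $1\le n\le N$ (so that $d_1,\dots,d_N$ are determined by $d_0$ through the recurrence relation $Md=q_0d$ and the quotients below make sense). Then $d_0\ne0$. Define $$C'=\frac{2^{\beta+2N'}\sqrt\pi}{\Gamma(\frac12-\frac\beta2-N')}\sum_{n=0}^{N'}\frac{d_{2N'-2n}}{4^n(\frac12-\frac\beta2-N')_n},\qquad D'=\frac{2^{\beta+1+2N'}\sqrt\pi}{\Gamma(-\frac\beta2-N')}\sum_{n=0}^{N'}\frac{d_{2N'-2n}}{4^n(-\frac\beta2-N')_n},$$ $$C''=\frac{2^{\beta+1+2N''}\sqrt\pi}{\Gamma(-\frac\beta2-N'')}\sum_{n=0}^{N''}\frac{d_{2N''-2n+1}}{4^n(-\frac\beta2-N'')_n},\qquad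 D''=\frac{2^{\beta+2+2N''}\sqrt\pi}{\Gamma(-\frac\beta2-\frac12-N'')}\sum_{n=0}^{N''}\frac{d_{2N''-2n+1}}{4^n(-\frac\beta2-\frac12-N'')_n},$$ and the polynomials $$g'(X)=\sum_{n=0}^{N'}\sum_{k=0}^n\frac{d_{2N'-2n}}{4^n(\frac12-\frac\beta2-N')_n}\,\frac{\binom nk}{(-\frac\beta2-N')_k}\,X(X-1)\cdots(X-k+1),$$ $$h'(X)=\sum_{n=0}^{N'}\sum_{k=0}^n\frac{d_{2N'-2n}}{4^n(-\frac\beta2-N')_n}\,\frac{\binom nk}{(\frac12-\frac\beta2-N')_k}\,X(X-1)\cdots(X-k+1),$$ $$g''(X)=\sum_{n=0}^{N''}\sum_{k=0}^n\frac{d_{2N''-2n+1}}{4^n(-\frac\beta2-N'')_n}\,\frac{\binom nk}{(-\frac\beta2-\frac12-N'')_k}\,X(X-1)\cdots(X-k+1),$$ $$h''(X)=\sum_{n=0}^{N''}\sum_{k=0}^n\frac{d_{2N''-2n+1}}{4^n(-\frac\beta2-\frac12-N'')_n}\,\frac{\binom nk}{(-\frac\beta2-N'')_k}\,X(X-1)\cdots(X-k+1).$$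 Let $\lambda'_j,\mu'_j,\lambda''_j,\mu''_j$ be the roots of $g',h',g'',h''$ respectively, counted with multiplicity and multiplied by $-1$ (no parameters if the polynomial is zero). There are $N'$ numbers $\lambda'_j$ and $N'$ numbers $\mu'_j$, and, if $d_1\ne0$, there are $N''$ numbers $\lambda''_j$ and $N''$ numbers $\mu''_j$ (for $N=0$, and more generally if all $d_{2j+1}$ vanish, the terms with $C'',D''$ below are absent). If none of these numbers is one of $0,-1,-2,\dots$, then for all $z$ $$\begin{aligned}\Phi(z)={}&C'\,{}_{1+N'}F_{1+N'}\!\left(-\tfrac\beta2-N',\lambda'_1+1,\dots,\lambda'_{N'}+1;\tfrac12,\lambda'_1,\dots,\lambda'_{N'};\xi^2\right)\\ &-D'\xi\,{}_{1+N'}F_{1+N'}\!\left(\tfrac12-\tfrac\beta2-N',\mu'_1+1,\dots,\mu'_{N'}+1;\tfrac32,\mu'_1,\dots,\mu'_{N'};\xi^2\right)\\ &+C''\,{}_{1+N''}F_{1+N''}\!\left(-\tfrac\beta2-\tfrac12-N'',\lambda''_1+1,\dots,\lambda''_{N''}+1;\tfrac12,\lambda''_1,\dots,\lambda''_{N''};\xi^2\right)\\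 &-D''\xi\,{}_{1+N''}F_{1+N''}\!\left(-\tfrac\beta2-N'',\mu''_1+1,\dots,\mu''_{N''}+1;\tfrac32,\mu''_1,\dots,\mu''_{N''};\xi^2\right),\end{aligned}$$ so the right-hand side solves $(\ast)$. (If $d_1=0$, the last two functions have correspondingly fewer pairs of parameters, namely as many as the roots of $g''$, respectively $h''$.) **(c)** Under the assumptions of (b), normalize $d_0=1$, and write $P_k(x)=2^{\beta+k}\sqrt\pi/\Gamma(x)$. Then the following hold. * $N=0$: $\Phi=P_0(\frac12-\frac\beta2)\,{}_1F_1(-\frac\beta2;\frac12;\xi^2)-P_1(-\frac\beta2)\,\xi\,{}_1F_1(\frac12-\frac\beta2;\frac32;\xi^2)$. * $N=1$: $d_1=\frac{p_1+q_0}{2(1+\beta)}$ and $\Phi=d_0P_0(\frac12-\frac\beta2)\,{}_1F_1(-\frac\beta2;\frac12;\xi^2)+d_1P_1(-\frac\beta2)\,{}_1F_1(-\frac\beta2-\frac12;\frac12;\xi^2)-d_0P_1(-\frac\beta2)\,\xi\,{}_1F_1(\frac12-\frac\beta2;\frac32;\xi^2)-d_1P_2(-\frac\beta2-\frac12)\,\xi\,{}_1F_1(-\frac\beta2;\frac32;\xi^2)$.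 * $N=2$: $d_1=\frac{2p_1+q_0}{2(1+\beta)}$, $d_2=\frac{2+(p_1+q_0)d_1}{4(2+\beta)}$, and, with $C=1+4d_2(-\frac\beta2-\frac12)$, $D=1+4d_2(-\frac\beta2-1)$, provided that no extra parameter is one of $0,-1,-2,\dots$, $\Phi=P_0(\frac12-\frac\beta2)\,C\,{}_2F_2(-\frac\beta2-1,(-\frac\beta2-1)C+1;\frac12,(-\frac\beta2-1)C;\xi^2)+d_1P_1(-\frac\beta2)\,{}_1F_1(-\frac\beta2-\frac12;\frac12;\xi^2)-P_1(-\frac\beta2)\,D\,\xi\,{}_2F_2(-\frac\beta2-\frac12,(-\frac\beta2-\frac12)D+1;\frac32,(-\frac\beta2-\frac12)D;\xi^2)-d_1P_2(-\frac\beta2-\frac12)\,\xi\,{}_1F_1(-\frac\beta2;\frac32;\xi^2)$. * $N=3$: $d_1=\frac{3p_1+q_0}{2(1+\beta)}$, $d_2=\frac{3+(2p_1+q_0)d_1}{4(2+\beta)}$, $d_3=\frac{2d_1+(p_1+q_0)d_2}{6(3+\beta)}$, and, if $d_1\ne0$ and no extra parameter is one of $0,-1,-2,\dots$, then with $\mathcal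 C'=1+4(-\frac\beta2-\frac12)\frac{d_2}{d_0}$, $\mathcal D'=1+4(-\frac\beta2-1)\frac{d_2}{d_0}$, $\mathcal C''=1+4(-\frac\beta2-1)\frac{d_3}{d_1}$, $\mathcal D''=1+4(-\frac\beta2-\frac32)\frac{d_3}{d_1}$, $\Phi=P_0(\frac12-\frac\beta2)\,d_0\mathcal C'\,{}_2F_2(-\frac\beta2-1,(-\frac\beta2-1)\mathcal C'+1;\frac12,(-\frac\beta2-1)\mathcal C';\xi^2)+P_1(-\frac\beta2)\,d_1\mathcal C''\,{}_2F_2(-\frac\beta2-\frac32,(-\frac\beta2-\frac32)\mathcal C''+1;\frac12,(-\frac\beta2-\frac32)\mathcal C'';\xi^2)-P_1(-\frac\beta2)\,d_0\mathcal D'\,\xi\,{}_2F_2(-\frac\beta2-\frac12,(-\frac\beta2-\frac12)\mathcal D'+1;\frac32,(-\frac\beta2-\frac12)\mathcal D';\xi^2)-P_2(-\frac\beta2-\frac12)\,d_1\mathcal D''\,\xi\,{}_2F_2(-\frac\beta2-1,(-\frac\beta2-1)\mathcal D''+1;\frac32,(-\frac\beta2-1)\mathcal D'';\xi^2)$. 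-/

import Mathlib

open scoped Nat Polynomial

noncomputable section

namespace BiconfluentHeun

/-- `Φ` is an entire solution of the biconfluent Heun equation
`z Φ'' + (p₀ + p₁ s z - 2 s² z²) Φ' + (q₀ s + q₁ s² z) Φ = 0`. -/
def IsSolution (p₀ p₁ q₀ q₁ s : ℂ) (Φ : ℂ → ℂ) : Prop :=
  Differentiable ℂ Φ ∧
    ∀ z : ℂ, z * deriv (deriv Φ) z + (p₀ + p₁ * s * z - 2 * s ^ 2 * z ^ 2) * deriv Φ z
      + (q₀ * s + q₁ * s ^ 2 * z) * Φ z = 0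

/-- The rising factorial `(a)_n = a (a + 1) ⋯ (a + n - 1)`. -/
def poch (a : ℂ) (n : ℕ) : ℂ := (ascPochhammer ℂ n).eval a

/-- The generalized hypergeometric function `_pF_q(a; b; z)`, where `a` and `b` are the families
(multisets) of numerator and denominator parameters: Mathlib's regularized function multiplied by
`∏ Γ(b_i)`.  The usual power series is recovered in `pFq_eq_tsum`. -/
def pFq (a b : Multiset ℂ) (z : ℂ) : ℂ :=
  (b.map Complex.Gamma).prod * Complex.regularizedHGFun a b z

/-- `pFq` is the usual power series when no denominator parameter is `0, -1, -2, …`. -/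
theorem pFq_eq_tsum (a b : Multiset ℂ) (z : ℂ) (hb : ∀ x ∈ b, ∀ m : ℕ, x ≠ -(m : ℂ)) :
    pFq a b z = ∑' n : ℕ,
      (a.map (fun x => poch x n)).prod / (b.map (fun x => poch x n)).prod * z ^ n / (n ! : ℂ) := by
  have key : ∀ n : ℕ, (b.map Complex.Gamma).prod * (b.map fun x => poch x n).prod
      = (b.map fun x => Complex.Gamma (x + n)).prod := by
    intro n
    rw [← Multiset.prod_map_mul]
    refine congrArg _ (Multiset.map_congr rfl fun x hx => ?_)
    have := Complex.Gamma_add_nat_div_Gamma_eq (n := n) x (hb x hx)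
    rw [poch, ← this, mul_div_cancel₀ _ (Complex.Gamma_ne_zero (hb x hx))]
  have hG : (b.map Complex.Gamma).prod ≠ 0 := by
    refine Multiset.prod_ne_zero fun h => ?_
    obtain ⟨x, hx, h0⟩ := Multiset.mem_map.mp h
    exact Complex.Gamma_ne_zero (hb x hx) h0
  have hs : Complex.regularizedHGFun a b z =
      ∑' n : ℕ, Complex.regularizedHGFunCoeff a b n * z ^ n := by
    unfold Complex.regularizedHGFun FormalMultilinearSeries.sum Complex.regularizedHGFunSeries
    simp [mul_comm]
  rw [pFq, hs, ← tsum_mul_left]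
  refine tsum_congr fun n => ?_
  unfold Complex.regularizedHGFunCoeff
  rw [← key n]
  have hfac : ((n ! : ℕ) : ℂ) ≠ 0 := by exact_mod_cast n.factorial_ne_zero
  change _ * ((a.map fun x => poch x n).prod / _ * _) = _
  rw [← mul_assoc, mul_div_assoc', mul_comm ((n ! : ℕ) : ℂ), mul_assoc (b.map Complex.Gamma).prod,
    mul_div_mul_left _ _ hG]
  rw [← div_div]
  ring

/-- The Hermite function `H_ν(x)` of arbitrary complex order `ν`. Recall that `1 / Γ` vanishes at
the poles of `Γ`, in agreement with the convention `Complex.Gamma (-n) = 0`, `1 / 0 = 0`. -/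
def hermiteH (ν x : ℂ) : ℂ :=
  (2 : ℂ) ^ ν * (√Real.pi : ℂ) / Complex.Gamma (1 / 2 - ν / 2)
      * pFq {-ν / 2} {1 / 2} (x ^ 2)
    - (2 : ℂ) ^ (ν + 1) * (√Real.pi : ℂ) / Complex.Gamma (-ν / 2)
      * x * pFq {1 / 2 - ν / 2} {3 / 2} (x ^ 2)

/-- The infinite tridiagonal matrix of the recurrence relation for the coefficients of the
expansion in Hermite functions, for `p₀ = -N`; rows and columns are numbered from `0`. -/
def hermiteMatrix (N : ℕ) (p₁ q₁ : ℂ) : Matrix ℕ ℕ ℂ :=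
  Matrix.of fun i j =>
    if j = i then ((i : ℂ) - N) * p₁
    else if j = i + 1 then 2 * (j : ℂ) * ((j : ℂ) - N) + (j : ℂ) * q₁
    else if i = j + 1 then (j : ℂ) - N
    else 0

/-- Its upper left `(N + 1) × (N + 1)` minor, as a linear map. -/
def hermiteMinor (N : ℕ) (p₁ q₁ : ℂ) : (Fin (N + 1) → ℂ) →ₗ[ℂ] (Fin (N + 1) → ℂ) :=
  Matrix.toLin' ((hermiteMatrix N p₁ q₁).submatrix (fun i => (i : ℕ)) (fun j => (j : ℕ)))

/-- `d₀, …, d_N` are the components of an eigenvector of the minor for the eigenvalue `q₀`, and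
the sequence `d` is extended by zero. -/
def IsCoeffs (N : ℕ) (p₁ q₁ q₀ : ℂ) (d : ℕ → ℂ) : Prop :=
  Module.End.HasEigenvector (hermiteMinor N p₁ q₁) q₀ (fun i : Fin (N + 1) => d i) ∧
    ∀ n, N < n → d n = 0

/-- The terminating Hermite-function expansion
`Φ(z) = ∑_{n=0}^N d_n H_{p₀ + q₁/2 + n}(s z - p₁/2)`. -/
def hermiteSum (N : ℕ) (p₀ p₁ q₁ s : ℂ) (d : ℕ → ℂ) (z : ℂ) : ℂ :=
  ∑ n ∈ Finset.range (N + 1), d n * hermiteH (p₀ + q₁ / 2 + n) (s * z - p₁ / 2)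

/-- `N' = ⌊N / 2⌋`. -/
def half' (N : ℕ) : ℕ := N / 2

/-- `N'' = ⌊(N - 1) / 2⌋`.  For `N = 0` this is `0`; the sums to which it applies
then have the single term with `d₁ = 0`, that is, they vanish. -/
def half'' (N : ℕ) : ℕ := (N - 1) / 2

/-- `d_{2N'}, d_{2N'-2}, …, d₀`. -/
def evenCoeff (N : ℕ) (d : ℕ → ℂ) (n : ℕ) : ℂ := d (2 * half' N - 2 * n)

/-- `d_{2N''+1}, d_{2N''-1}, …, d₁`. -/
def oddCoeff (N : ℕ) (d : ℕ → ℂ) (n : ℕ) : ℂ := d (2 * half'' N - 2 * n + 1)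

/-- `∑_{n=0}^M e_n / (4ⁿ (a)_n)`. -/
def ampSum (M : ℕ) (e : ℕ → ℂ) (a : ℂ) : ℂ :=
  ∑ n ∈ Finset.range (M + 1), e n / (4 ^ n * poch a n)

/-- The polynomial
`∑_{n=0}^M ∑_{k=0}^n e_n / (4ⁿ (a)_n) · C(n, k) / (α)_k · X (X - 1) ⋯ (X - k + 1)`. -/
def auxPoly (M : ℕ) (e : ℕ → ℂ) (a α : ℂ) : ℂ[X] :=
  ∑ n ∈ Finset.range (M + 1), ∑ k ∈ Finset.range (n + 1),
    Polynomial.C (e n / (4 ^ n * poch a n) * ((n.choose k : ℂ) / poch α k))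
      * descPochhammer ℂ k

section parameters

variable (N : ℕ) (β : ℂ) (d : ℕ → ℂ)

/-- The amplitude `C'`. -/
def ampC' : ℂ :=
  (2 : ℂ) ^ (β + 2 * half' N) * (√Real.pi : ℂ) / Complex.Gamma (1 / 2 - β / 2 - half' N)
    * ampSum (half' N) (evenCoeff N d) (1 / 2 - β / 2 - half' N)

/-- The amplitude `D'`. -/
def ampD' : ℂ :=
  (2 : ℂ) ^ (β + 1 + 2 * half' N) * (√Real.pi : ℂ) / Complex.Gamma (-β / 2 - half' N)
    * ampSum (half' N) (evenCoeff N d) (-β / 2 - half' N)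

/-- The amplitude `C''`. -/
def ampC'' : ℂ :=
  (2 : ℂ) ^ (β + 1 + 2 * half'' N) * (√Real.pi : ℂ) / Complex.Gamma (-β / 2 - half'' N)
    * ampSum (half'' N) (oddCoeff N d) (-β / 2 - half'' N)

/-- The amplitude `D''`. -/
def ampD'' : ℂ :=
  (2 : ℂ) ^ (β + 2 + 2 * half'' N) * (√Real.pi : ℂ)
      / Complex.Gamma (-β / 2 - 1 / 2 - half'' N)
    * ampSum (half'' N) (oddCoeff N d) (-β / 2 - 1 / 2 - half'' N)

/-- The polynomial `g'`. -/
def polyG' : ℂ[X] :=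
  auxPoly (half' N) (evenCoeff N d) (1 / 2 - β / 2 - half' N) (-β / 2 - half' N)

/-- The polynomial `h'`. -/
def polyH' : ℂ[X] :=
  auxPoly (half' N) (evenCoeff N d) (-β / 2 - half' N) (1 / 2 - β / 2 - half' N)

/-- The polynomial `g''`. -/
def polyG'' : ℂ[X] :=
  auxPoly (half'' N) (oddCoeff N d) (-β / 2 - half'' N) (-β / 2 - 1 / 2 - half'' N)

/-- The polynomial `h''`. -/
def polyH'' : ℂ[X] :=
  auxPoly (half'' N) (oddCoeff N d) (-β / 2 - 1 / 2 - half'' N) (-β / 2 - half'' N)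

/-- The roots of `g`, counted with multiplicity and multiplied by `-1`. -/
def negRoots (g : ℂ[X]) : Multiset ℂ := g.roots.map (fun x => -x)

/-- The parameters `λ'`. -/
def lam' : Multiset ℂ := negRoots (polyG' N β d)

/-- The parameters `μ'`. -/
def mu' : Multiset ℂ := negRoots (polyH' N β d)

/-- The parameters `λ''`. -/
def lam'' : Multiset ℂ := negRoots (polyG'' N β d)

/-- The parameters `μ''`. -/
def mu'' : Multiset ℂ := negRoots (polyH'' N β d)

/-- None of the extra parameters, which occur as denominator parameters of generalized
hypergeometric functions, is one of the numbers `0, -1, -2, …`. -/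
def Admissible : Prop :=
  ∀ x ∈ lam' N β d + mu' N β d + lam'' N β d + mu'' N β d, ∀ m : ℕ, x ≠ -(m : ℂ)

/-- `_{1+r}F_{1+r}(α, l₁ + 1, …, l_r + 1; γ, l₁, …, l_r; x)`. -/
def shiftedF (α γ : ℂ) (l : Multiset ℂ) (x : ℂ) : ℂ :=
  pFq (α ::ₘ l.map (fun t => t + 1)) (γ ::ₘ l) x

/-- The linear combination of four generalized hypergeometric functions, in the variable `ξ`. -/
def fourTerm (ξ : ℂ) : ℂ :=
  ampC' N β d * shiftedF (-β / 2 - half' N) (1 / 2) (lam' N β d) (ξ ^ 2)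
    - ampD' N β d * ξ * shiftedF (1 / 2 - β / 2 - half' N) (3 / 2) (mu' N β d) (ξ ^ 2)
    + ampC'' N β d * shiftedF (-β / 2 - 1 / 2 - half'' N) (1 / 2) (lam'' N β d) (ξ ^ 2)
    - ampD'' N β d * ξ * shiftedF (-β / 2 - half'' N) (3 / 2) (mu'' N β d) (ξ ^ 2)

end parameters

section explicit

variable (β ξ : ℂ)

/-- `2^{β+k} √π / Γ(x)`. -/
def pref (k : ℕ) (x : ℂ) : ℂ := (2 : ℂ) ^ (β + k) * (√Real.pi : ℂ) / Complex.Gamma x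

/-- The explicit solution for `N = 0`. -/
def explicit0 : ℂ :=
  pref β 0 (1 / 2 - β / 2) * pFq {-β / 2} {1 / 2} (ξ ^ 2)
    - pref β 1 (-β / 2) * ξ * pFq {1 / 2 - β / 2} {3 / 2} (ξ ^ 2)

/-- The explicit solution for `N = 1`. -/
def explicit1 (d₀ d₁ : ℂ) : ℂ :=
  d₀ * pref β 0 (1 / 2 - β / 2) * pFq {-β / 2} {1 / 2} (ξ ^ 2)
    + d₁ * pref β 1 (-β / 2) * pFq {-β / 2 - 1 / 2} {1 / 2} (ξ ^ 2)
    - d₀ * pref β 1 (-β / 2) * ξ * pFq {1 / 2 - β / 2} {3 / 2} (ξ ^ 2)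
    - d₁ * pref β 2 (-β / 2 - 1 / 2) * ξ * pFq {-β / 2} {3 / 2} (ξ ^ 2)

/-- The explicit solution for `N = 2`. -/
def explicit2 (d₁ C D : ℂ) : ℂ :=
  pref β 0 (-β / 2 + 1 / 2) * C
      * pFq {-β / 2 - 1, (-β / 2 - 1) * C + 1} {1 / 2, (-β / 2 - 1) * C} (ξ ^ 2)
    + d₁ * pref β 1 (-β / 2) * pFq {-β / 2 - 1 / 2} {1 / 2} (ξ ^ 2)
    - pref β 1 (-β / 2) * D * ξ
      * pFq {-β / 2 - 1 / 2, (-β / 2 - 1 / 2) * D + 1} {3 / 2, (-β / 2 - 1 / 2) * D} (ξ ^ 2)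
    - d₁ * pref β 2 (-β / 2 - 1 / 2) * ξ * pFq {-β / 2} {3 / 2} (ξ ^ 2)

/-- The explicit solution for `N = 3`. -/
def explicit3 (d₀ d₁ C' D' C'' D'' : ℂ) : ℂ :=
  pref β 0 (-β / 2 + 1 / 2) * (d₀ * C')
      * pFq {-β / 2 - 1, (-β / 2 - 1) * C' + 1} {1 / 2, (-β / 2 - 1) * C'} (ξ ^ 2)
    + pref β 1 (-β / 2) * (d₁ * C'')
      * pFq {-β / 2 - 3 / 2, (-β / 2 - 3 / 2) * C'' + 1}
          {1 / 2, (-β / 2 - 3 / 2) * C''} (ξ ^ 2)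
    - pref β 1 (-β / 2) * (d₀ * D') * ξ
      * pFq {-β / 2 - 1 / 2, (-β / 2 - 1 / 2) * D' + 1}
          {3 / 2, (-β / 2 - 1 / 2) * D'} (ξ ^ 2)
    - pref β 2 (-β / 2 - 1 / 2) * (d₁ * D'') * ξ
      * pFq {-β / 2 - 1, (-β / 2 - 1) * D'' + 1} {3 / 2, (-β / 2 - 1) * D''} (ξ ^ 2)

end explicit

end BiconfluentHeun

end

/-!
The substitution `ξ = s z - p₁/2` turns the equation into
`w (F'' - 2 ξ F') + p₀ F' + (q₀ + q₁ w) F = 0` with `w = ξ + p₁/2`. The Hermite functions satisfy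
`H_ν' = 2 ν H_{ν-1}` and `H_{ν+1} = 2 ξ H_ν - 2 ν H_{ν-1}` (`hasDerivAt_hermiteH`,
`hermiteH_add_one`), both consequences of contiguous relations for Kummer's function. Hence the
operator maps `H_{β+n}` to a combination of `H_{β+n-1}`, `H_{β+n}`, `H_{β+n+1}`, and the relation
`M d = q₀ d` makes the image of `∑ d_n H_{β+n}` telescope to zero (`sum_hermite_telescope`,
`isSolution_hermiteSum`). The sum does not vanish identically, because the `H_{β+n}` are
eigenvectors of `f ↦ f'' - 2 x f'` for the distinct eigenvalues `-2 (β + n)`.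

For the hypergeometric form, the orders are separated by parity, and the even and the odd parts of
the Hermite functions are Kummer functions of `ξ²` whose first parameters `α + n` differ by
integers. Since `(α + n)_m = (α)_m (α + m)_n / (α)_n` and, by Chu–Vandermonde, `(α + m)_n` is a
combination of the falling factorials of `m`, each of the four sums has Taylor coefficients
`g(m) (α)_m / ((γ)_m m!)` with a polynomial `g`. If `-λ_j` are the roots of `g`, then
`g(m) = g(0) ∏ (λ_j + 1)_m / (λ_j)_m`, so the sum is `g(0)` times a single generalized
hypergeometric function (`ampSum_mul_shiftedF`). The condition `β + n ≠ 0` ensures that no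
denominator vanishes and that the leading coefficient of `g` is a nonzero multiple of `d₀` or `d₁`.
-/

noncomputable section

namespace BiconfluentHeun

/-! ### Rising factorials -/

@[simp] lemma poch_zero (a : ℂ) : poch a 0 = 1 := by simp [poch]

lemma poch_succ (a : ℂ) (n : ℕ) : poch a (n + 1) = poch a n * (a + n) := by
  simp [poch, ascPochhammer_succ_right]

lemma poch_one (a : ℂ) : poch a 1 = a := by simp [poch]

lemma poch_succ_left (a : ℂ) (n : ℕ) : poch a (n + 1) = a * poch (a + 1) n := by
  simp [poch, ascPochhammer_succ_left]

lemma poch_add (a : ℂ) (n m : ℕ) : poch a (n + m) = poch a n * poch (a + n) m := by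
  simp [poch, ← ascPochhammer_mul]

lemma poch_ne_zero {a : ℂ} {n : ℕ} (h : ∀ m < n, a ≠ -(m : ℂ)) : poch a n ≠ 0 := by
  rw [poch, Ne, ascPochhammer_eval_eq_zero_iff]
  rintro ⟨m, hm, h'⟩
  exact h m hm (by rw [h', neg_neg])

lemma poch_ne_zero_of_le {a : ℂ} {n m : ℕ} (h : poch a m ≠ 0) (hn : n ≤ m) : poch a n ≠ 0 := by
  obtain ⟨k, rfl⟩ := Nat.exists_eq_add_of_le hn
  rw [poch_add] at h
  exact left_ne_zero_of_mul h

/-- Holds for every `a`, since `1 / Γ` takes the value `0` at the poles of `Γ`. -/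
lemma one_div_Gamma_eq_poch_mul (a : ℂ) (n : ℕ) :
    (Complex.Gamma a)⁻¹ = poch a n * (Complex.Gamma (a + n))⁻¹ := by
  induction n with
  | zero => simp
  | succ n ih =>
    rw [ih, Complex.one_div_Gamma_eq_self_mul_one_div_Gamma_add_one (a + n), poch_succ]
    push_cast
    ring_nf

/-! ### The confluent hypergeometric function -/

/-- The power series of `pFq` converges everywhere when there are at least as many denominator as
numerator parameters. -/
lemma hasSum_pFq {a b : Multiset ℂ} (h : a.card ≤ b.card) (hb : ∀ x ∈ b, ∀ m : ℕ, x ≠ -(m : ℂ))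
    (z : ℂ) :
    HasSum (fun n : ℕ => (a.map (fun x => poch x n)).prod / (b.map (fun x => poch x n)).prod
      * z ^ n / (n ! : ℂ)) (pFq a b z) := by
  have key : ∀ n : ℕ, (b.map Complex.Gamma).prod * (b.map fun x => poch x n).prod
      = (b.map fun x => Complex.Gamma (x + n)).prod := by
    intro n
    rw [← Multiset.prod_map_mul]
    refine congrArg _ (Multiset.map_congr rfl fun x hx => ?_)
    have := Complex.Gamma_add_nat_div_Gamma_eq (n := n) x (hb x hx)
    rw [poch, ← this, mul_div_cancel₀ _ (Complex.Gamma_ne_zero (hb x hx))]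
  have hG : (b.map Complex.Gamma).prod ≠ 0 := by
    refine Multiset.prod_ne_zero fun h => ?_
    obtain ⟨x, hx, h0⟩ := Multiset.mem_map.mp h
    exact Complex.Gamma_ne_zero (hb x hx) h0
  have hs : HasSum (fun n => Complex.regularizedHGFunSeries a b n fun _ => z)
      (Complex.regularizedHGFun a b z) := by
    apply FormalMultilinearSeries.hasSum
    rw [Complex.radius_regularizedHGFunSeries_eq_top h]
    simp
  convert! hs.mul_left (b.map Complex.Gamma).prod using 1
  ext n
  rw [FormalMultilinearSeries.apply_eq_pow_smul_coeff, Complex.regularizedHGFunSeries_coeff]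
  unfold Complex.regularizedHGFunCoeff
  rw [← key n, smul_eq_mul]
  change _ = _ * (_ * ((a.map fun x => poch x n).prod / _))
  rw [div_mul_eq_mul_div, div_div, mul_comm (n ! : ℂ), mul_assoc, mul_div_assoc', mul_div_assoc',
    mul_div_mul_left _ _ hG]
  ring

/-- A parameter that may occur in the denominator of a hypergeometric series. -/
def IsGood (b : ℂ) : Prop := ∀ m : ℕ, b ≠ -(m : ℂ)

lemma IsGood.add_one {b : ℂ} (hb : IsGood b) : IsGood (b + 1) := fun m h =>
  hb (m + 1) (by push_cast; linear_combination h)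

lemma isGood_half : IsGood (1 / 2) := by
  intro m h
  have := congrArg Complex.re h
  simp at this
  linarith [(Nat.cast_nonneg m : (0 : ℝ) ≤ m)]

lemma isGood_three_halves : IsGood (3 / 2) := by
  have := isGood_half.add_one
  norm_num at this
  exact this

lemma IsGood.add_natCast_ne_zero {b : ℂ} (hb : IsGood b) (n : ℕ) : b + n ≠ 0 := fun h =>
  hb n (by linear_combination h)

lemma IsGood.poch_ne_zero {b : ℂ} (hb : IsGood b) (n : ℕ) : poch b n ≠ 0 :=
  BiconfluentHeun.poch_ne_zero fun m _ => hb m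

/-- Kummer's function `₁F₁(a; b; z)`. -/
abbrev kummer (a b z : ℂ) : ℂ := pFq {a} {b} z

lemma hasSum_kummer (a : ℂ) {b : ℂ} (hb : IsGood b) (z : ℂ) :
    HasSum (fun n : ℕ => poch a n / poch b n * z ^ n / (n ! : ℂ)) (kummer a b z) := by
  simpa using hasSum_pFq (a := {a}) (b := {b}) (by simp) (by simpa [IsGood] using hb) z

lemma kummer_zero (a : ℂ) {b : ℂ} (hb : IsGood b) : kummer a b 0 = 1 := by
  refine (hasSum_kummer a hb 0).unique ?_
  convert! hasSum_single (f := fun n : ℕ => poch a n / poch b n * 0 ^ n / (n ! : ℂ)) 0 ?_ using 1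
  · simp
  · intro n hn
    simp [hn]

/-- The series of `z d/dz ₁F₁(a; b; z)`. -/
lemma hasSum_mul_kummer (a : ℂ) {b : ℂ} (hb : IsGood b) (z : ℂ) :
    HasSum (fun n : ℕ => n * (poch a n / poch b n) * z ^ n / (n ! : ℂ))
      (z * (a / b * kummer (a + 1) (b + 1) z)) := by
  rw [← hasSum_nat_add_iff' 1]
  convert! (hasSum_kummer (a + 1) hb.add_one z).mul_left (z * (a / b)) using 1
  · ext n
    have h1 : ((n ! : ℕ) : ℂ) ≠ 0 := by exact_mod_cast n.factorial_ne_zero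
    have h2 : (n : ℂ) + 1 ≠ 0 := by exact_mod_cast n.succ_ne_zero
    have h3 := hb.add_one.poch_ne_zero n
    have h4 := hb.add_natCast_ne_zero 0
    rw [poch_succ_left, poch_succ_left, Nat.factorial_succ]
    push_cast at h4 ⊢
    rw [add_zero] at h4
    field_simp
    ring
  · simp [mul_assoc]

lemma hasDerivAt_kummer (a : ℂ) {b : ℂ} (hb : IsGood b) (z : ℂ) :
    HasDerivAt (kummer a b) (a / b * kummer (a + 1) (b + 1) z) z := by
  set p := Complex.regularizedHGFunSeries {a} {b} with hp
  have hr : p.radius = ⊤ := Complex.radius_regularizedHGFunSeries_eq_top (by simp)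
  have hd : HasFDerivAt p.sum (p.derivSeries.sum z) z :=
    FormalMultilinearSeries.hasFDerivAt_sum (by rw [hr]; simp)
  have hd' : HasDerivAt (kummer a b) (Complex.Gamma b * p.derivSeries.sum z 1) z := by
    have := hd.hasDerivAt.const_mul (Complex.Gamma b)
    refine this.congr_of_eventuallyEq (Filter.Eventually.of_forall fun w => ?_)
    simp [kummer, pFq, Complex.regularizedHGFun, hp]
  have hs : HasSum (fun n => p.derivSeries n fun _ => z) (p.derivSeries.sum z) := by
    apply FormalMultilinearSeries.hasSum
    have : p.derivSeries.radius = ⊤ := top_le_iff.mp (hr ▸ p.radius_le_radius_derivSeries)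
    rw [this]
    simp
  have hs' := ((ContinuousLinearMap.apply ℂ ℂ (1 : ℂ)).hasSum hs).mul_left (Complex.Gamma b)
  have hs'' := (hasSum_kummer (a + 1) hb.add_one z).mul_left (a / b)
  have : Complex.Gamma b * p.derivSeries.sum z 1 = a / b * kummer (a + 1) (b + 1) z := by
    refine hs'.unique ?_
    convert! hs'' using 2 with n
    have h1 : ((n ! : ℕ) : ℂ) ≠ 0 := by exact_mod_cast n.factorial_ne_zero
    have h2 : (n : ℂ) + 1 ≠ 0 := by exact_mod_cast n.succ_ne_zero
    have h3 := hb.add_one.poch_ne_zero n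
    have h4 := hb.add_natCast_ne_zero 0
    have h5 := Complex.Gamma_ne_zero hb
    have h6 : Complex.Gamma (b + (n + 1 : ℕ)) = Complex.Gamma b * poch b (n + 1) := by
      rw [poch, ← Complex.Gamma_add_nat_div_Gamma_eq b hb, mul_div_cancel₀ _ h5]
    rw [FormalMultilinearSeries.apply_eq_pow_smul_coeff]
    simp only [ContinuousLinearMap.apply_apply, smul_apply,
      FormalMultilinearSeries.derivSeries_coeff_one, hp, Complex.regularizedHGFunSeries_coeff]
    have h7 : Complex.regularizedHGFunCoeff {a} {b} (n + 1)
        = poch a (n + 1) / ((n + 1)! * (Complex.Gamma b * poch b (n + 1))) := by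
      rw [← h6]
      simp [Complex.regularizedHGFunCoeff, poch]
    rw [h7, poch_succ_left, poch_succ_left, Nat.factorial_succ]
    push_cast at h4 ⊢
    rw [add_zero] at h4
    simp only [smul_eq_mul, nsmul_eq_mul]
    push_cast
    field_simp
  rwa [this] at hd'

/-- `(2 z d/dz + 1) ₁F₁(a; 3/2; z) = ₁F₁(a; 1/2; z)`. -/
lemma kummer_three_halves (a z : ℂ) :
    kummer a (3 / 2) z + 2 * z * (a / (3 / 2) * kummer (a + 1) (3 / 2 + 1) z)
      = kummer a (1 / 2) z := by
  have h1 := (hasSum_kummer a isGood_three_halves z).add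
    ((hasSum_mul_kummer a isGood_three_halves z).mul_left 2)
  rw [mul_assoc 2 z]
  refine h1.unique ?_
  convert! hasSum_kummer a isGood_half z using 2 with n
  have h2 := isGood_three_halves.poch_ne_zero n
  have h3 := isGood_half.add_natCast_ne_zero n
  have h4 : poch (1 / 2) n = 1 / 2 * poch (3 / 2) n / (1 / 2 + n) := by
    rw [eq_div_iff h3, ← poch_succ, poch_succ_left]
    norm_num
  have h1 : ((n ! : ℕ) : ℂ) ≠ 0 := by exact_mod_cast n.factorial_ne_zero
  rw [h4]
  have h5 : 1 + (n : ℂ) * 2 ≠ 0 := fun h => h3 (by linear_combination h / 2)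
  field_simp

lemma poch_add_one_mul (a : ℂ) (n : ℕ) : a * poch (a + 1) n = poch a n * (a + n) := by
  rw [← poch_succ_left, poch_succ]

lemma mul_kummer_add_one (a : ℂ) {b : ℂ} (hb : IsGood b) (z : ℂ) :
    a * kummer (a + 1) b z = a * kummer a b z + z * (a / b * kummer (a + 1) (b + 1) z) := by
  refine ((hasSum_kummer (a + 1) hb z).mul_left a).unique ?_
  convert! ((hasSum_kummer a hb z).mul_left a).add (hasSum_mul_kummer a hb z) using 2 with n
  have := poch_add_one_mul a n
  linear_combination this / poch b n * z ^ n / (n ! : ℂ)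

lemma kummer_add_one_sub (a : ℂ) {b : ℂ} (hb : IsGood b) (z : ℂ) :
    kummer (a + 1) b z - kummer a b z = z / b * kummer (a + 1) (b + 1) z := by
  have h0 := (hasSum_kummer (a + 1) hb z).sub (hasSum_kummer a hb z)
  refine h0.unique ?_
  rw [← hasSum_nat_add_iff' 1]
  convert! (hasSum_kummer (a + 1) hb.add_one z).mul_left (z / b) using 1
  · ext n
    have h1 : ((n ! : ℕ) : ℂ) ≠ 0 := by exact_mod_cast n.factorial_ne_zero
    have h2 : (n : ℂ) + 1 ≠ 0 := by exact_mod_cast n.succ_ne_zero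
    have h3 := hb.add_one.poch_ne_zero n
    have h4 := hb.add_natCast_ne_zero 0
    rw [poch_succ (a + 1), poch_succ_left a, poch_succ_left b, Nat.factorial_succ]
    push_cast at h4 ⊢
    rw [add_zero] at h4
    field_simp
    ring
  · simp

/-! ### Hermite functions of complex order -/

lemma hermiteH_eq (ν x : ℂ) : hermiteH ν x = (2 : ℂ) ^ ν * (√Real.pi : ℂ) *
    ((Complex.Gamma (1 / 2 - ν / 2))⁻¹ * kummer (-ν / 2) (1 / 2) (x ^ 2)
      - 2 * x * (Complex.Gamma (-ν / 2))⁻¹ * kummer (1 / 2 - ν / 2) (3 / 2) (x ^ 2)) := by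
  rw [hermiteH, Complex.cpow_add _ _ two_ne_zero, Complex.cpow_one]
  ring

lemma hasDerivAt_hermiteH (ν x : ℂ) : HasDerivAt (hermiteH ν) (2 * ν * hermiteH (ν - 1) x) x := by
  have hsq : HasDerivAt (fun x : ℂ => x ^ 2) (2 * x) x := by simpa using hasDerivAt_pow 2 x
  have he := ((hasDerivAt_kummer (-ν / 2) isGood_half (x ^ 2)).comp x hsq).const_mul
    (Complex.Gamma (1 / 2 - ν / 2))⁻¹
  have ho := (((hasDerivAt_id x).const_mul 2).mul_const (Complex.Gamma (-ν / 2))⁻¹).mul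
    ((hasDerivAt_kummer (1 / 2 - ν / 2) isGood_three_halves (x ^ 2)).comp x hsq)
  have h := (he.sub ho).const_mul ((2 : ℂ) ^ ν * (√Real.pi : ℂ))
  rw [show hermiteH ν = _ from funext (hermiteH_eq ν)]
  convert! h using 1
  rw [hermiteH_eq]
  have h2 : (2 : ℂ) ^ (ν - 1) = 2 ^ ν / 2 := by
    rw [Complex.cpow_sub _ _ two_ne_zero, Complex.cpow_one]
  have g := Complex.one_div_Gamma_eq_self_mul_one_div_Gamma_add_one (-ν / 2)
  have k := kummer_three_halves (1 / 2 - ν / 2) (x ^ 2)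
  rw [h2, show (1 : ℂ) / 2 - (ν - 1) / 2 = -ν / 2 + 1 by ring,
    show -(ν - 1) / 2 = 1 / 2 - ν / 2 by ring, ← k, show (3 : ℂ) / 2 = 1 / 2 + 1 by norm_num]
  simp only [id, Function.comp]
  rw [g]
  ring

lemma hermiteH_add_one (ν x : ℂ) :
    hermiteH (ν + 1) x = 2 * x * hermiteH ν x - 2 * ν * hermiteH (ν - 1) x := by
  simp only [hermiteH_eq]
  have h1 : (2 : ℂ) ^ (ν + 1) = 2 ^ ν * 2 := by
    rw [Complex.cpow_add _ _ two_ne_zero, Complex.cpow_one]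
  have h2 : (2 : ℂ) ^ (ν - 1) = 2 ^ ν / 2 := by
    rw [Complex.cpow_sub _ _ two_ne_zero, Complex.cpow_one]
  have g := Complex.one_div_Gamma_eq_self_mul_one_div_Gamma_add_one (-ν / 2)
  have g' := Complex.one_div_Gamma_eq_self_mul_one_div_Gamma_add_one (-ν / 2 - 1 / 2)
  rw [show -ν / 2 - 1 / 2 + 1 = 1 / 2 - ν / 2 by ring] at g'
  -- even part: `M(c, 1/2) = M(c + 1, 1/2) - 2 t M(c + 1, 3/2)` with `c = -ν/2 - 1/2`
  have k := kummer_add_one_sub (-ν / 2 - 1 / 2) isGood_half (x ^ 2)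
  rw [show -ν / 2 - 1 / 2 + 1 = 1 / 2 - ν / 2 by ring,
    show (1 : ℂ) / 2 + 1 = 3 / 2 by norm_num] at k
  -- odd part: `(1 - 2 a) M(a, 3/2) = M(a, 1/2) - 2 a M(a + 1, 3/2)` with `a = -ν/2`
  have k1 := kummer_three_halves (-ν / 2) (x ^ 2)
  have k2 := mul_kummer_add_one (-ν / 2) isGood_three_halves (x ^ 2)
  rw [h1, h2, show (1 : ℂ) / 2 - (ν + 1) / 2 = -ν / 2 by ring,
    show -(ν + 1) / 2 = -ν / 2 - 1 / 2 by ring,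
    show (1 : ℂ) / 2 - (ν - 1) / 2 = -ν / 2 + 1 by ring,
    show -(ν - 1) / 2 = 1 / 2 - ν / 2 by ring, g', g]
  linear_combination (-2 * 2 ^ ν * (√Real.pi : ℂ) * (-ν / 2 * (Complex.Gamma (-ν / 2 + 1))⁻¹)) * k
    + (2 ^ ν * (√Real.pi : ℂ) * 2 * x * (Complex.Gamma (1 / 2 - ν / 2))⁻¹) * k1
    + (2 ^ ν * (√Real.pi : ℂ) * 4 * x * (Complex.Gamma (1 / 2 - ν / 2))⁻¹) * k2

lemma differentiable_hermiteH (ν : ℂ) : Differentiable ℂ (hermiteH ν) := fun x =>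
  (hasDerivAt_hermiteH ν x).differentiableAt

/-- At the origin `H_ν` and `H_ν'` are multiples of `1 / Γ(1/2 - ν/2)` and `1 / Γ(-ν/2)`, which
have no common zero. -/
lemma hermiteH_ne_zero (ν : ℂ) : hermiteH ν ≠ 0 := by
  intro h
  have h0 : ∀ μ : ℂ, hermiteH μ 0 = 0 → ∃ m : ℕ, 1 / 2 - μ / 2 = -(m : ℂ) := by
    intro μ hμ
    rw [hermiteH_eq] at hμ
    simp only [ne_eq, OfNat.ofNat_ne_zero, not_false_eq_true, zero_pow, mul_zero, zero_mul,
      sub_zero, kummer_zero _ isGood_half, mul_one, mul_eq_zero, inv_eq_zero,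
      Complex.cpow_eq_zero_iff, OfNat.ofNat_ne_zero, false_and, false_or] at hμ
    rcases hμ with hμ | hμ
    · have := Real.sqrt_pos.mpr Real.pi_pos
      exact absurd (by exact_mod_cast hμ) this.ne'
    · exact (Complex.Gamma_eq_zero_iff _).mp hμ
  obtain ⟨m, hm⟩ := h0 ν (by rw [h]; rfl)
  have hd : 2 * ν * hermiteH (ν - 1) 0 = 0 := by
    rw [← (hasDerivAt_hermiteH ν 0).deriv, h]
    exact deriv_const 0 0
  -- `ν = 2 m + 1` is odd, so neither `ν = 0` nor `ν = 2 k` is possible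
  rcases mul_eq_zero.mp hd with hν | hν
  · have hν0 : ν = 0 := by simpa using hν
    have : (1 : ℂ) + 2 * m = 0 := by rw [hν0] at hm; linear_combination 2 * hm
    exact absurd (by exact_mod_cast this : 1 + 2 * m = 0) (by omega)
  · obtain ⟨k, hk⟩ := h0 _ hν
    have : (2 : ℂ) * m = 2 * k + 1 := by linear_combination 2 * hm - 2 * hk
    exact absurd (by exact_mod_cast this : 2 * m = 2 * k + 1) (by omega)

/-! ### The recurrence relation of the coefficients -/

/-- The eigenvalue equation, row by row. The sum may include the column `N + 1`, as `d` vanishes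
there; this makes the last row look like the others. -/
lemma hermiteMatrix_mulVec {N : ℕ} {p₁ q₁ q₀ : ℂ} {d : ℕ → ℂ} (hd : IsCoeffs N p₁ q₁ q₀ d)
    {i : ℕ} (hi : i ≤ N) :
    ∑ j ∈ Finset.range (N + 2), hermiteMatrix N p₁ q₁ i j * d j = q₀ * d i := by
  have h := congrFun hd.1.apply_eq_smul ⟨i, Nat.lt_succ_of_le hi⟩
  rw [Finset.sum_range_succ, hd.2 _ (Nat.lt_succ_self N), mul_zero, add_zero,
    ← Fin.sum_univ_eq_sum_range (fun j => hermiteMatrix N p₁ q₁ i j * d j)]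
  simpa [hermiteMinor, Matrix.mulVec, dotProduct] using h

/-- The relation carried by the first row of the matrix. -/
lemma IsCoeffs.row_zero {N : ℕ} {p₁ q₁ q₀ : ℂ} {d : ℕ → ℂ} (hd : IsCoeffs N p₁ q₁ q₀ d) :
    -N * p₁ * d 0 + (2 * (1 - N) + q₁) * d 1 = q₀ * d 0 := by
  rw [← hermiteMatrix_mulVec hd (Nat.zero_le N),
    ← Finset.sum_subset (Finset.range_subset_range.mpr (Nat.le_add_left 2 N))]
  · simp [Finset.sum_range_succ, hermiteMatrix]
  · intro j _ hj
    rw [Finset.mem_range, not_lt] at hj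
    simp [hermiteMatrix, show j ≠ 0 by omega, show j ≠ 1 by omega]

lemma IsCoeffs.row_succ {N : ℕ} {p₁ q₁ q₀ : ℂ} {d : ℕ → ℂ} (hd : IsCoeffs N p₁ q₁ q₀ d)
    {n : ℕ} (hn : n + 1 ≤ N) :
    ((n : ℂ) - N) * d n + ((n : ℂ) + 1 - N) * p₁ * d (n + 1)
      + (n + 2) * (2 * (n + 2 - N) + q₁) * d (n + 2) = q₀ * d (n + 1) := by
  rw [← hermiteMatrix_mulVec hd hn]
  have hsub : ({n, n + 1, n + 2} : Finset ℕ) ⊆ Finset.range (N + 2) := by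
    intro j hj
    simp only [Finset.mem_insert, Finset.mem_singleton] at hj
    rw [Finset.mem_range]
    omega
  rw [← Finset.sum_subset hsub]
  · rw [Finset.sum_insert (by simp), Finset.sum_insert (by simp), Finset.sum_singleton]
    simp [hermiteMatrix, show n ≠ n + 1 + 1 by omega]
    ring
  · intro j _ hj
    simp only [Finset.mem_insert, Finset.mem_singleton, not_or] at hj
    simp [hermiteMatrix, show j ≠ n + 1 by omega, show j ≠ n + 1 + 1 by omega,
      show ¬ n = j by omega]

lemma exists_isCoeffs {N : ℕ} {p₁ q₁ q₀ : ℂ}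
    (hq₀ : Module.End.HasEigenvalue (hermiteMinor N p₁ q₁) q₀) :
    ∃ d : ℕ → ℂ, IsCoeffs N p₁ q₁ q₀ d := by
  obtain ⟨v, hv⟩ := hq₀.exists_hasEigenvector
  refine ⟨fun n => if h : n < N + 1 then v ⟨n, h⟩ else 0, ?_, fun n hn => ?_⟩
  · convert! hv using 1
    ext i
    simp [i.2]
  · simp [show ¬ n < N + 1 by omega]

lemma IsCoeffs.exists_ne_zero {N : ℕ} {p₁ q₁ q₀ : ℂ} {d : ℕ → ℂ} (hd : IsCoeffs N p₁ q₁ q₀ d) :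
    ∃ n ≤ N, d n ≠ 0 := by
  by_contra! h
  exact hd.1.2 (funext fun i => h i (Nat.le_of_lt_succ i.2))

/-- The factors `2 n (β + n)` on the upper diagonal do not vanish, so that all coefficients are
multiples of the first one. -/
lemma IsCoeffs.zero_ne_zero {N : ℕ} {p₁ q₁ q₀ : ℂ} {d : ℕ → ℂ} (hd : IsCoeffs N p₁ q₁ q₀ d)
    (hβ : ∀ n : ℕ, 1 ≤ n → n ≤ N → -(N : ℂ) + q₁ / 2 + n ≠ 0) : d 0 ≠ 0 := by
  intro h0
  have key : ∀ n, d n = 0 ∧ d (n + 1) = 0 := by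
    intro n
    induction n with
    | zero =>
      refine ⟨h0, ?_⟩
      by_cases hN : 1 ≤ N
      · have h := hd.row_zero
        rw [h0] at h
        have hb := hβ 1 le_rfl hN
        push_cast at hb
        have : 2 * (-(N : ℂ) + q₁ / 2 + 1) * d 1 = 0 := by linear_combination h
        simpa [hb] using this
      · exact hd.2 _ (by omega)
    | succ n ih =>
      refine ⟨ih.2, ?_⟩
      by_cases hN : n + 2 ≤ N
      · have h := hd.row_succ (n := n) (by omega)
        rw [ih.1, ih.2] at h
        have hb := hβ (n + 2) (by omega) hN
        push_cast at hb
        have h2 : (n : ℂ) + 2 ≠ 0 := by exact_mod_cast (n + 1).succ_ne_zero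
        have : ((n : ℂ) + 2) * (-(N : ℂ) + q₁ / 2 + (n + 2)) * d (n + 2) = 0 := by
          linear_combination h / 2
        simpa [hb, h2] using this
      · exact hd.2 _ (by omega)
  obtain ⟨n, -, hn⟩ := hd.exists_ne_zero
  exact hn (key n).1

/-! ### The expansion solves the equation -/

lemma hasDerivAt_hermiteH_comp (ν p s z : ℂ) :
    HasDerivAt (fun z => hermiteH ν (s * z - p)) (s * (2 * ν * hermiteH (ν - 1) (s * z - p))) z := by
  have h : HasDerivAt (fun z : ℂ => s * z - p) s z := by
    simpa using ((hasDerivAt_id z).const_mul s).sub_const p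
  convert! (hasDerivAt_hermiteH ν (s * z - p)).comp z h using 1
  ring

lemma hasDerivAt_hermiteSum (N : ℕ) (p₀ p₁ q₁ s : ℂ) (d : ℕ → ℂ) (z : ℂ) :
    HasDerivAt (hermiteSum N p₀ p₁ q₁ s d) (∑ n ∈ Finset.range (N + 1),
      d n * (s * (2 * (p₀ + q₁ / 2 + n) * hermiteH (p₀ + q₁ / 2 + n - 1) (s * z - p₁ / 2)))) z :=
  HasDerivAt.fun_sum fun n _ => (hasDerivAt_hermiteH_comp _ _ s z).const_mul (d n)

lemma hasDerivAt_deriv_hermiteSum (N : ℕ) (p₀ p₁ q₁ s : ℂ) (d : ℕ → ℂ) (z : ℂ) :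
    HasDerivAt (deriv (hermiteSum N p₀ p₁ q₁ s d)) (∑ n ∈ Finset.range (N + 1),
      d n * (s * (2 * (p₀ + q₁ / 2 + n) * (s * (2 * (p₀ + q₁ / 2 + n - 1)
        * hermiteH (p₀ + q₁ / 2 + n - 1 - 1) (s * z - p₁ / 2)))))) z := by
  rw [funext fun z => (hasDerivAt_hermiteSum N p₀ p₁ q₁ s d z).deriv]
  exact HasDerivAt.fun_sum fun n _ =>
    (((hasDerivAt_hermiteH_comp _ _ s z).const_mul _).const_mul _).const_mul (d n)

/-- In the basis of Hermite functions, the left-hand side of the equation is a telescoping sum by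
the recurrence relation; both ends vanish, at the upper one because `p₀ = -N`. -/
lemma sum_hermite_telescope {N : ℕ} {p₁ q₁ q₀ : ℂ} {d : ℕ → ℂ} (hd : IsCoeffs N p₁ q₁ q₀ d)
    (h : ℕ → ℂ) :
    ∑ n ∈ Finset.range (N + 1), d n * (((N : ℂ) - n) * h (n + 2)
      + (q₀ + ((N : ℂ) - n) * p₁) * h (n + 1) - 2 * (-(N : ℂ) + q₁ / 2 + n) * n * h n) = 0 := by
  have key : ∀ k ≤ N, ∑ n ∈ Finset.range (k + 1), d n * (((N : ℂ) - n) * h (n + 2)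
      + (q₀ + ((N : ℂ) - n) * p₁) * h (n + 1) - 2 * (-(N : ℂ) + q₁ / 2 + n) * n * h n)
      = d k * (N - k) * h (k + 2)
        + 2 * (-(N : ℂ) + q₁ / 2 + (k + 1)) * (k + 1) * d (k + 1) * h (k + 1) := by
    intro k
    induction k with
    | zero =>
      intro _
      rw [Finset.sum_range_one]
      push_cast
      simp only [zero_add]
      linear_combination -(h 1) * hd.row_zero
    | succ k ih =>
      intro hk
      rw [Finset.sum_range_succ, ih (by omega)]
      push_cast
      linear_combination -(h (k + 2)) * hd.row_succ hk
  rw [key N le_rfl, hd.2 (N + 1) (Nat.lt_succ_self N)]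
  ring

theorem isSolution_hermiteSum {N : ℕ} {p₁ q₀ q₁ : ℂ} (s : ℂ) {d : ℕ → ℂ}
    (hd : IsCoeffs N p₁ q₁ q₀ d) :
    IsSolution (-(N : ℂ)) p₁ q₀ q₁ s (hermiteSum N (-(N : ℂ)) p₁ q₁ s d) := by
  refine ⟨fun z => (hasDerivAt_hermiteSum _ _ _ _ _ _ z).differentiableAt, fun z => ?_⟩
  rw [(hasDerivAt_deriv_hermiteSum _ _ _ _ _ _ z).deriv,
    (hasDerivAt_hermiteSum _ _ _ _ _ _ z).deriv, hermiteSum,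
    ← mul_zero s, ← sum_hermite_telescope hd
      (fun n => hermiteH (-(N : ℂ) + q₁ / 2 + n - 1) (s * z - p₁ / 2)),
    Finset.mul_sum, Finset.mul_sum, Finset.mul_sum, Finset.mul_sum, ← Finset.sum_add_distrib,
    ← Finset.sum_add_distrib]
  refine Finset.sum_congr rfl fun n _ => ?_
  have r1 := hermiteH_add_one (-(N : ℂ) + q₁ / 2 + n) (s * z - p₁ / 2)
  have r2 := hermiteH_add_one (-(N : ℂ) + q₁ / 2 + n - 1) (s * z - p₁ / 2)
  rw [sub_add_cancel] at r2
  push_cast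
  rw [show -(N : ℂ) + q₁ / 2 + (n + 2) - 1 = -(N : ℂ) + q₁ / 2 + n + 1 by ring,
    show -(N : ℂ) + q₁ / 2 + (n + 1) - 1 = -(N : ℂ) + q₁ / 2 + n by ring]
  linear_combination (-s * d n * (N - n)) * r1
    + (2 * s ^ 2 * z * d n * (-(N : ℂ) + q₁ / 2 + n)) * r2

/-! ### Linear independence of Hermite functions of distinct orders -/

/-- The space of entire functions. -/
def entireFunctions : Submodule ℂ (ℂ → ℂ) where
  carrier := {f | Differentiable ℂ f}
  add_mem' hf hg := hf.add hg
  zero_mem' := differentiable_const 0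
  smul_mem' c _ hf := hf.const_smul c

lemma differentiable_deriv {f : ℂ → ℂ} (hf : Differentiable ℂ f) : Differentiable ℂ (deriv f) :=
  fun x => (hf.analyticAt x).deriv.differentiableAt

/-- The Hermite operator `f ↦ f'' - 2 x f'` on entire functions. -/
def hermiteOperator : Module.End ℂ entireFunctions where
  toFun f := ⟨fun x => deriv (deriv f.1) x - 2 * x * deriv f.1 x,
    (differentiable_deriv (differentiable_deriv f.2)).sub
      ((differentiable_id.const_mul 2).mul (differentiable_deriv f.2))⟩
  map_add' f g := by
    have h1 : deriv (f.1 + g.1) = deriv f.1 + deriv g.1 :=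
      funext fun x => deriv_add (f.2 x) (g.2 x)
    have h2 : deriv (deriv f.1 + deriv g.1) = deriv (deriv f.1) + deriv (deriv g.1) :=
      funext fun x => deriv_add (differentiable_deriv f.2 x) (differentiable_deriv g.2 x)
    ext x
    simp only [Submodule.coe_add, h1, h2, Pi.add_apply]
    ring
  map_smul' c f := by
    have h1 : deriv (c • f.1) = c • deriv f.1 := funext fun x => deriv_const_smul c (f.2 x)
    have h2 : deriv (c • deriv f.1) = c • deriv (deriv f.1) :=
      funext fun x => deriv_const_smul c (differentiable_deriv f.2 x)
    ext x
    simp only [Submodule.coe_smul, h1, h2, Pi.smul_apply, smul_eq_mul, RingHom.id_apply]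
    ring

/-- Hermite's differential equation `H_ν'' - 2 x H_ν' + 2 ν H_ν = 0`. -/
lemma hasEigenvector_hermiteH (ν : ℂ) : hermiteOperator.HasEigenvector (-2 * ν)
    ⟨hermiteH ν, differentiable_hermiteH ν⟩ := by
  refine ⟨Module.End.mem_eigenspace_iff.mpr ?_, fun h => hermiteH_ne_zero ν (Subtype.ext_iff.mp h)⟩
  ext x
  have h1 : deriv (hermiteH ν) = fun x => 2 * ν * hermiteH (ν - 1) x :=
    funext fun x => (hasDerivAt_hermiteH ν x).deriv
  have h2 := ((hasDerivAt_hermiteH (ν - 1) x).const_mul (2 * ν)).deriv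
  have h3 := hermiteH_add_one (ν - 1) x
  rw [sub_add_cancel] at h3
  change deriv (deriv (hermiteH ν)) x - 2 * x * deriv (hermiteH ν) x = -2 * ν * hermiteH ν x
  rw [h1, h2]
  linear_combination 2 * ν * h3

/-- For `s ≠ 0` the map `z ↦ s z - p₁/2` is onto, so that the expansion inherits the linear
independence of the Hermite functions. -/
theorem exists_hermiteSum_ne_zero {N : ℕ} {p₁ q₀ q₁ s : ℂ} (p₀ : ℂ) {d : ℕ → ℂ}
    (hd : IsCoeffs N p₁ q₁ q₀ d) (hs : s ≠ 0) : ∃ z, hermiteSum N p₀ p₁ q₁ s d z ≠ 0 := by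
  by_contra! h
  have hli := Module.End.eigenvectors_linearIndependent' hermiteOperator
    (fun n : ℕ => -2 * (p₀ + q₁ / 2 + n)) (fun m n hmn => by simpa using hmn) _
    (fun n => hasEigenvector_hermiteH (p₀ + q₁ / 2 + n))
  obtain ⟨n, hn, hdn⟩ := hd.exists_ne_zero
  refine hdn (linearIndependent_iff'.mp hli (Finset.range (N + 1)) d ?_ n
    (Finset.mem_range_succ_iff.mpr hn))
  ext ξ
  have := h ((ξ + p₁ / 2) / s)
  rw [hermiteSum, mul_div_cancel₀ _ hs, add_sub_cancel_right] at this
  simpa using this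

/-! ### Sums of contiguous Kummer functions as one generalized hypergeometric function -/

/-- The Chu–Vandermonde identity for rising factorials. -/
lemma poch_add_left (x y : ℂ) (n : ℕ) :
    poch (x + y) n = ∑ k ∈ Finset.range (n + 1),
      (n.choose k : ℂ) * poch (x + k) (n - k) * (descPochhammer ℂ k).eval y := by
  have conv : ∀ (r : ℂ) (k : ℕ), (descPochhammer ℤ k).smeval r = poch (r - k + 1) k := fun r k => by
    rw [Polynomial.descPochhammer_smeval_eq_ascPochhammer,
      Polynomial.ascPochhammer_smeval_eq_eval, poch]
  -- `(x + y)_n` is the falling factorial of `y + (x + n - 1)`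
  have h := Ring.descPochhammer_smeval_add n (Commute.all y (x + n - 1))
  rw [Finset.Nat.sum_antidiagonal_eq_sum_range_succ_mk] at h
  simp only [conv] at h
  rw [show y + (x + n - 1) - n + 1 = x + y by ring] at h
  rw [h]
  refine Finset.sum_congr rfl fun k hk => ?_
  have hk : k ≤ n := Finset.mem_range_succ_iff.mp hk
  rw [descPochhammer_eval_eq_ascPochhammer, ← poch, Nat.cast_sub hk,
    show x + (n : ℂ) - 1 - (n - k) + 1 = x + k by ring]
  ring

lemma poch_add_natCast_mul (α : ℂ) (n m : ℕ) :
    poch α n * poch (α + n) m = poch α m * poch (α + m) n := by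
  rw [← poch_add, ← poch_add, add_comm]

/-- The values of the auxiliary polynomial at the natural numbers. -/
lemma auxPoly_eval_natCast (M : ℕ) (e : ℕ → ℂ) (a : ℂ) {α : ℂ} (hα : poch α M ≠ 0) (m : ℕ) :
    (auxPoly M e a α).eval (m : ℂ) * poch α m
      = ∑ n ∈ Finset.range (M + 1), e n / (4 ^ n * poch a n) * poch (α + n) m := by
  rw [auxPoly, Polynomial.eval_finsetSum, Finset.sum_mul]
  refine Finset.sum_congr rfl fun n hn => ?_
  have hn : n ≤ M := Finset.mem_range_succ_iff.mp hn
  have hαn := poch_ne_zero_of_le hα hn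
  have h : poch (α + n) m = poch α m * poch (α + m) n / poch α n := by
    rw [← poch_add_natCast_mul, mul_div_cancel_left₀ _ hαn]
  rw [h, poch_add_left, Polynomial.eval_finsetSum, Finset.sum_mul, Finset.mul_sum, Finset.sum_div,
    Finset.mul_sum]
  refine Finset.sum_congr rfl fun k hk => ?_
  have hk : k ≤ n := Finset.mem_range_succ_iff.mp hk
  have hs : poch α n = poch α k * poch (α + k) (n - k) := by
    rw [← poch_add, Nat.add_sub_cancel' hk]
  rw [hs] at hαn ⊢
  have h1 := left_ne_zero_of_mul hαn
  have h2 := right_ne_zero_of_mul hαn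
  simp only [Polynomial.eval_mul, Polynomial.eval_C]
  field_simp

lemma auxPoly_eval_zero (M : ℕ) (e : ℕ → ℂ) (a : ℂ) {α : ℂ} (hα : poch α M ≠ 0) :
    (auxPoly M e a α).eval 0 = ampSum M e a := by
  simpa [ampSum] using auxPoly_eval_natCast M e a hα 0

lemma hasSum_sum_kummer (M : ℕ) (e : ℕ → ℂ) (a : ℂ) {α γ : ℂ} (hα : poch α M ≠ 0)
    (hγ : IsGood γ) (t : ℂ) :
    HasSum (fun m : ℕ => (auxPoly M e a α).eval (m : ℂ) * (poch α m / poch γ m * t ^ m / (m ! : ℂ)))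
      (∑ n ∈ Finset.range (M + 1), e n / (4 ^ n * poch a n) * kummer (α + n) γ t) := by
  convert! hasSum_sum fun n (_ : n ∈ Finset.range (M + 1)) =>
    (hasSum_kummer (α + n) hγ t).mul_left (e n / (4 ^ n * poch a n)) using 1
  ext m
  have h := auxPoly_eval_natCast M e a hα m
  calc _ = (auxPoly M e a α).eval (m : ℂ) * poch α m * (t ^ m / poch γ m / (m ! : ℂ)) := by ring
    _ = _ := by
      rw [h, Finset.sum_mul]
      exact Finset.sum_congr rfl fun n _ => by ring

/-- A polynomial is recovered from its value at `0` and its negated roots. -/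
lemma eval_zero_mul_poch_negRoots {g : ℂ[X]} (hg : ∀ x ∈ negRoots g, IsGood x) (m : ℕ) :
    g.eval 0 * (((negRoots g).map fun x => poch (x + 1) m).prod
      / ((negRoots g).map fun x => poch x m).prod) = g.eval (m : ℂ) := by
  have hev : ∀ y : ℂ, g.eval y = g.leadingCoeff * ((negRoots g).map fun x => x + y).prod := by
    intro y
    conv_lhs => rw [(IsAlgClosed.splits g).eq_prod_roots]
    rw [Polynomial.eval_mul, Polynomial.eval_C, Polynomial.eval_multiset_prod, negRoots,
      Multiset.map_map, Multiset.map_map]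
    simp [sub_eq_neg_add]
  have hne : ((negRoots g).map fun x => poch x m).prod ≠ 0 := by
    refine Multiset.prod_ne_zero fun h => ?_
    obtain ⟨x, hx, h0⟩ := Multiset.mem_map.mp h
    exact (hg x hx).poch_ne_zero m h0
  rw [hev, hev, mul_div_assoc', div_eq_iff hne, mul_assoc, mul_assoc, ← Multiset.prod_map_mul,
    ← Multiset.prod_map_mul]
  congr 2
  refine Multiset.map_congr rfl fun x _ => ?_
  rw [add_zero, poch_add_one_mul, mul_comm]

lemma hasSum_shiftedF (α : ℂ) {γ : ℂ} (hγ : IsGood γ) {g : ℂ[X]}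
    (hg : ∀ x ∈ negRoots g, IsGood x) (t : ℂ) :
    HasSum (fun m : ℕ => g.eval (m : ℂ) * (poch α m / poch γ m * t ^ m / (m ! : ℂ)))
      (g.eval 0 * shiftedF α γ (negRoots g) t) := by
  have h := (hasSum_pFq (a := α ::ₘ (negRoots g).map fun x => x + 1) (b := γ ::ₘ negRoots g)
    (by simp) (by
      intro x hx
      rcases Multiset.mem_cons.mp hx with rfl | hx
      · exact hγ
      · exact hg x hx) t).mul_left (g.eval 0)
  convert! h using 1
  ext m
  rw [← eval_zero_mul_poch_negRoots hg m]
  simp only [Multiset.map_cons, Multiset.prod_cons, Multiset.map_map, Function.comp_def]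
  ring

/-- Finite sums of Kummer functions with contiguous first parameters are single generalized
hypergeometric functions: both sides have the Taylor coefficients `g(m) (α)_m / ((γ)_m m!)`, where
`g` is the auxiliary polynomial. -/
lemma ampSum_mul_shiftedF (M : ℕ) (e : ℕ → ℂ) (a : ℂ) {α γ : ℂ} (hα : poch α M ≠ 0)
    (hγ : IsGood γ) (hg : ∀ x ∈ negRoots (auxPoly M e a α), IsGood x) (t : ℂ) :
    ampSum M e a * shiftedF α γ (negRoots (auxPoly M e a α)) t
      = ∑ n ∈ Finset.range (M + 1), e n / (4 ^ n * poch a n) * kummer (α + n) γ t := by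
  rw [← auxPoly_eval_zero M e a hα]
  exact (hasSum_shiftedF α hγ hg t).unique (hasSum_sum_kummer M e a hα hγ t)

/-! ### The number of extra parameters -/

lemma card_negRoots (g : ℂ[X]) : (negRoots g).card = g.natDegree := by
  rw [negRoots, Multiset.card_map, (IsAlgClosed.splits g).natDegree_eq_card_roots]

/-- Only the summand `n = k = M` contributes to the coefficient of `X ^ M`. -/
lemma natDegree_auxPoly {M : ℕ} {e : ℕ → ℂ} {a α : ℂ} (ha : poch a M ≠ 0) (hα : poch α M ≠ 0)
    (he : e M ≠ 0) : (auxPoly M e a α).natDegree = M := by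
  have hmonic : ∀ k, (descPochhammer ℂ k).coeff k = 1 := fun k => by
    have := monic_descPochhammer ℂ k
    rwa [Polynomial.Monic, Polynomial.leadingCoeff, descPochhammer_natDegree] at this
  refine Polynomial.natDegree_eq_of_le_of_coeff_ne_zero ?_ ?_
  · refine Polynomial.natDegree_sum_le_of_forall_le _ _ fun n hn =>
      Polynomial.natDegree_sum_le_of_forall_le _ _ fun k hk => ?_
    refine (Polynomial.natDegree_C_mul_le _ _).trans ?_
    rw [descPochhammer_natDegree]
    rw [Finset.mem_range] at hn hk
    omega
  · have hlt : ∀ n k, k < M → (Polynomial.C (e n / (4 ^ n * poch a n)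
        * ((n.choose k : ℂ) / poch α k)) * descPochhammer ℂ k).coeff M = 0 := by
      intro n k hk
      refine Polynomial.coeff_eq_zero_of_natDegree_lt
        ((Polynomial.natDegree_C_mul_le _ _).trans_lt ?_)
      rwa [descPochhammer_natDegree]
    rw [auxPoly, Finset.sum_range_succ, Finset.sum_range_succ, Polynomial.coeff_add,
      Polynomial.coeff_add, Polynomial.finsetSum_coeff, Polynomial.finsetSum_coeff,
      Finset.sum_eq_zero, Finset.sum_eq_zero, Polynomial.coeff_C_mul, hmonic]
    · simp [he, ha, hα]
    · exact fun k hk => hlt M k (Finset.mem_range.mp hk)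
    · intro n hn
      rw [Polynomial.finsetSum_coeff]
      refine Finset.sum_eq_zero fun k hk => hlt n k ?_
      rw [Finset.mem_range] at hn hk
      omega

/-! ### The Hermite expansion as a combination of four hypergeometric functions -/

/-- Lowering the order of a Hermite function by `2 n` divides the prefactor by `4 ^ n (a)_n`. This
remains true at the poles of `Γ`, where both sides vanish. -/
lemma two_cpow_div_Gamma_add (ν a : ℂ) {n : ℕ} (ha : poch a n ≠ 0) :
    (2 : ℂ) ^ (ν - 2 * n) * (Complex.Gamma (a + n))⁻¹
      = (2 : ℂ) ^ ν * (Complex.Gamma a)⁻¹ / (4 ^ n * poch a n) := by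
  have h4 : (2 : ℂ) ^ (2 * (n : ℂ)) = 4 ^ n := by
    rw [show (2 * (n : ℂ)) = ((2 * n : ℕ) : ℂ) by push_cast; ring, Complex.cpow_natCast, pow_mul]
    norm_num
  rw [Complex.cpow_sub _ _ two_ne_zero, h4, one_div_Gamma_eq_poch_mul a n]
  field_simp

/-- The sum of the Hermite functions whose orders differ from `ν` by even integers. -/
lemma sum_mul_hermiteH (M : ℕ) (e : ℕ → ℂ) (ν x : ℂ) (hE : poch (1 / 2 - ν / 2) M ≠ 0)
    (hO : poch (-ν / 2) M ≠ 0)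
    (hg : ∀ y ∈ negRoots (auxPoly M e (1 / 2 - ν / 2) (-ν / 2)), IsGood y)
    (hh : ∀ y ∈ negRoots (auxPoly M e (-ν / 2) (1 / 2 - ν / 2)), IsGood y) :
    ∑ n ∈ Finset.range (M + 1), e n * hermiteH (ν - 2 * n) x
      = (2 : ℂ) ^ ν * (√Real.pi : ℂ) / Complex.Gamma (1 / 2 - ν / 2)
          * ampSum M e (1 / 2 - ν / 2)
          * shiftedF (-ν / 2) (1 / 2) (negRoots (auxPoly M e (1 / 2 - ν / 2) (-ν / 2))) (x ^ 2)
        - (2 : ℂ) ^ (ν + 1) * (√Real.pi : ℂ) / Complex.Gamma (-ν / 2)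
          * ampSum M e (-ν / 2) * x
          * shiftedF (1 / 2 - ν / 2) (3 / 2) (negRoots (auxPoly M e (-ν / 2) (1 / 2 - ν / 2)))
            (x ^ 2) := by
  have h1 := ampSum_mul_shiftedF M e _ hO isGood_half hg (x ^ 2)
  have h2 := ampSum_mul_shiftedF M e _ hE isGood_three_halves hh (x ^ 2)
  rw [mul_assoc _ (ampSum M e (1 / 2 - ν / 2)), h1,
    mul_assoc _ (ampSum M e (-ν / 2)) x, mul_comm _ x, ← mul_assoc _ x, mul_assoc _ (ampSum _ _ _),
    h2, Finset.mul_sum, Finset.mul_sum, ← Finset.sum_sub_distrib]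
  refine Finset.sum_congr rfl fun n hn => ?_
  have hn : n ≤ M := Finset.mem_range_succ_iff.mp hn
  have g1 := two_cpow_div_Gamma_add ν (1 / 2 - ν / 2) (poch_ne_zero_of_le hE hn)
  have g2 := two_cpow_div_Gamma_add (ν + 1) (-ν / 2) (poch_ne_zero_of_le hO hn)
  rw [hermiteH, show (1 : ℂ) / 2 - (ν - 2 * n) / 2 = 1 / 2 - ν / 2 + n by ring,
    show -(ν - 2 * n) / 2 = -ν / 2 + n by ring, show ν - 2 * n + 1 = ν + 1 - 2 * n by ring]
  linear_combination (e n * (√Real.pi : ℂ) * kummer (-ν / 2 + n) (1 / 2) (x ^ 2)) * g1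
    - (e n * (√Real.pi : ℂ) * x * kummer (1 / 2 - ν / 2 + n) (3 / 2) (x ^ 2)) * g2

lemma sum_range_two_mul (f : ℕ → ℂ) (k : ℕ) : ∑ n ∈ Finset.range (2 * k), f n
    = ∑ n ∈ Finset.range k, f (2 * n) + ∑ n ∈ Finset.range k, f (2 * n + 1) := by
  induction k with
  | zero => simp
  | succ k ih =>
    rw [show 2 * (k + 1) = 2 * k + 1 + 1 by ring, Finset.sum_range_succ, Finset.sum_range_succ, ih,
      Finset.sum_range_succ, Finset.sum_range_succ]
    ring

/-- Splitting a sum according to the parity of the index, each half in descending order. -/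
lemma sum_range_eq_even_add_odd {N : ℕ} {f : ℕ → ℂ} (hf : ∀ n, N < n → f n = 0) :
    ∑ n ∈ Finset.range (N + 1), f n
      = ∑ n ∈ Finset.range (half' N + 1), f (2 * half' N - 2 * n)
        + ∑ n ∈ Finset.range (half'' N + 1), f (2 * half'' N - 2 * n + 1) := by
  have hr : ∀ (g : ℕ → ℂ) (M : ℕ), ∑ n ∈ Finset.range (M + 1), g (2 * M - 2 * n)
      = ∑ n ∈ Finset.range (M + 1), g (2 * n) := by
    intro g M
    rw [← Finset.sum_range_reflect]
    refine Finset.sum_congr rfl fun n hn => ?_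
    rw [Finset.mem_range] at hn
    congr 1
    omega
  rw [hr, hr fun n => f (n + 1)]
  have hsub : ∀ {g : ℕ → ℂ} {k l : ℕ}, k ≤ l → (∀ n, k ≤ n → g n = 0) →
      ∑ n ∈ Finset.range k, g n = ∑ n ∈ Finset.range l, g n := fun hkl hg =>
    Finset.sum_subset (Finset.range_subset_range.mpr hkl) fun n _ hn => hg n (by simpa using hn)
  rw [hsub (l := 2 * (N + 1)) (by omega) fun n hn => hf n (by omega), sum_range_two_mul,
    hsub (k := half' N + 1) (l := N + 1) (by unfold half'; omega) fun n hn => hf _ ?_,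
    hsub (k := half'' N + 1) (l := N + 1) (by unfold half''; omega) fun n hn => hf _ ?_]
  · unfold half'' at hn; omega
  · unfold half' at hn; omega

/-- A zero of one of the following four rising factorials would force `β` to be one of
`-1, …, -N`. -/
lemma poch_even_ne_zero {N : ℕ} {β : ℂ}
    (hβ : ∀ n : ℕ, 1 ≤ n → n ≤ N → β + n ≠ 0) :
    poch (1 / 2 - β / 2 - half' N) (half' N) ≠ 0 :=
  poch_ne_zero fun m hm h => by
    refine hβ (2 * (half' N - m) - 1) (by omega) (by unfold half' at *; omega) ?_
    rw [Nat.cast_sub (by omega), Nat.cast_mul, Nat.cast_sub hm.le]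
    push_cast
    linear_combination -2 * h

lemma poch_even_ne_zero' {N : ℕ} {β : ℂ}
    (hβ : ∀ n : ℕ, 1 ≤ n → n ≤ N → β + n ≠ 0) :
    poch (-β / 2 - half' N) (half' N) ≠ 0 :=
  poch_ne_zero fun m hm h => by
    refine hβ (2 * (half' N - m)) (by omega) (by unfold half' at *; omega) ?_
    rw [Nat.cast_mul, Nat.cast_sub hm.le]
    push_cast
    linear_combination -2 * h

lemma poch_odd_ne_zero {N : ℕ} {β : ℂ}
    (hβ : ∀ n : ℕ, 1 ≤ n → n ≤ N → β + n ≠ 0) :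
    poch (-β / 2 - half'' N) (half'' N) ≠ 0 :=
  poch_ne_zero fun m hm h => by
    refine hβ (2 * (half'' N - m)) (by omega) (by unfold half'' at *; omega) ?_
    rw [Nat.cast_mul, Nat.cast_sub hm.le]
    push_cast
    linear_combination -2 * h

lemma poch_odd_ne_zero' {N : ℕ} {β : ℂ}
    (hβ : ∀ n : ℕ, 1 ≤ n → n ≤ N → β + n ≠ 0) :
    poch (-β / 2 - 1 / 2 - half'' N) (half'' N) ≠ 0 :=
  poch_ne_zero fun m hm h => by
    refine hβ (2 * (half'' N - m) + 1) (by omega) (by unfold half'' at *; omega) ?_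
    rw [Nat.cast_add, Nat.cast_mul, Nat.cast_sub hm.le]
    push_cast
    linear_combination -2 * h

lemma card_lam'_mu' {N : ℕ} {β : ℂ}
    (hβ : ∀ n : ℕ, 1 ≤ n → n ≤ N → β + n ≠ 0) {d : ℕ → ℂ} (hd : d 0 ≠ 0) :
    (lam' N β d).card = half' N ∧ (mu' N β d).card = half' N := by
  have he : evenCoeff N d (half' N) ≠ 0 := by simpa [evenCoeff] using hd
  rw [lam', mu', card_negRoots, card_negRoots]
  exact ⟨natDegree_auxPoly (poch_even_ne_zero hβ) (poch_even_ne_zero' hβ) he,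
    natDegree_auxPoly (poch_even_ne_zero' hβ) (poch_even_ne_zero hβ) he⟩

lemma card_lam''_mu'' {N : ℕ} {β : ℂ}
    (hβ : ∀ n : ℕ, 1 ≤ n → n ≤ N → β + n ≠ 0) {d : ℕ → ℂ} (hd : d 1 ≠ 0) :
    (lam'' N β d).card = half'' N ∧ (mu'' N β d).card = half'' N := by
  have he : oddCoeff N d (half'' N) ≠ 0 := by simpa [oddCoeff] using hd
  rw [lam'', mu'', card_negRoots, card_negRoots]
  exact ⟨natDegree_auxPoly (poch_odd_ne_zero hβ) (poch_odd_ne_zero' hβ) he,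
    natDegree_auxPoly (poch_odd_ne_zero' hβ) (poch_odd_ne_zero hβ) he⟩

theorem sum_hermiteH_eq_fourTerm {N : ℕ} {β : ℂ}
    (hβ : ∀ n : ℕ, 1 ≤ n → n ≤ N → β + n ≠ 0) {d : ℕ → ℂ} (hd : ∀ n, N < n → d n = 0)
    (hadm : Admissible N β d) (x : ℂ) :
    ∑ n ∈ Finset.range (N + 1), d n * hermiteH (β + n) x = fourTerm N β d x := by
  rw [sum_range_eq_even_add_odd (fun n hn => by rw [hd n hn, zero_mul])]
  -- the highest orders of each parity are `β + 2 N'` and `β + 1 + 2 N''`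
  have e1 : (1 : ℂ) / 2 - (β + 2 * half' N) / 2 = 1 / 2 - β / 2 - half' N := by ring
  have e2 : -(β + 2 * half' N) / 2 = -β / 2 - half' N := by ring
  have e3 : (1 : ℂ) / 2 - (β + 1 + 2 * half'' N) / 2 = -β / 2 - half'' N := by ring
  have e4 : -(β + 1 + 2 * half'' N) / 2 = -β / 2 - 1 / 2 - half'' N := by ring
  have hE := sum_mul_hermiteH (half' N) (evenCoeff N d) (β + 2 * half' N) x
  have hO := sum_mul_hermiteH (half'' N) (oddCoeff N d) (β + 1 + 2 * half'' N) x
  rw [e1, e2] at hE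
  rw [e3, e4] at hO
  have hE := hE (poch_even_ne_zero hβ) (poch_even_ne_zero' hβ)
    (fun y hy => hadm y (by simp only [Multiset.mem_add]; exact .inl (.inl (.inl hy))))
    (fun y hy => hadm y (by simp only [Multiset.mem_add]; exact .inl (.inl (.inr hy))))
  have hO := hO (poch_odd_ne_zero hβ) (poch_odd_ne_zero' hβ)
    (fun y hy => hadm y (by simp only [Multiset.mem_add]; exact .inl (.inr hy)))
    (fun y hy => hadm y (by simp only [Multiset.mem_add]; exact .inr hy))
  have sE : ∑ n ∈ Finset.range (half' N + 1),
      d (2 * half' N - 2 * n) * hermiteH (β + (2 * half' N - 2 * n : ℕ)) x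
      = ∑ n ∈ Finset.range (half' N + 1),
        evenCoeff N d n * hermiteH (β + 2 * half' N - 2 * n) x := by
    refine Finset.sum_congr rfl fun n hn => ?_
    rw [Finset.mem_range] at hn
    rw [evenCoeff, Nat.cast_sub (by omega)]
    push_cast
    rw [add_sub_assoc]
  have sO : ∑ n ∈ Finset.range (half'' N + 1),
      d (2 * half'' N - 2 * n + 1) * hermiteH (β + (2 * half'' N - 2 * n + 1 : ℕ)) x
      = ∑ n ∈ Finset.range (half'' N + 1),
        oddCoeff N d n * hermiteH (β + 1 + 2 * half'' N - 2 * n) x := by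
    refine Finset.sum_congr rfl fun n hn => ?_
    rw [Finset.mem_range] at hn
    rw [oddCoeff, Nat.cast_add, Nat.cast_sub (by omega)]
    push_cast
    congr 2
    ring
  rw [sE, sO, hE, hO, fourTerm, ampC', ampD', ampC'', ampD'', lam', mu', lam'', mu'', polyG',
    polyH', polyG'', polyH'', show β + 2 * (half' N : ℂ) + 1 = β + 1 + 2 * half' N by ring,
    show β + 1 + 2 * (half'' N : ℂ) + 1 = β + 2 + 2 * half'' N by ring]
  ring

/-! ### The explicit formulas for `N ≤ 3` -/

lemma negRoots_C (c : ℂ) : negRoots (Polynomial.C c) = 0 := by simp [negRoots]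

lemma auxPoly_zero (e : ℕ → ℂ) (a α : ℂ) : auxPoly 0 e a α = Polynomial.C (e 0) := by
  simp [auxPoly]

lemma ampSum_zero (e : ℕ → ℂ) (a : ℂ) : ampSum 0 e a = e 0 := by simp [ampSum]

lemma shiftedF_zero (α γ x : ℂ) : shiftedF α γ 0 x = pFq {α} {γ} x := by simp [shiftedF]

lemma shiftedF_singleton (α γ l x : ℂ) : shiftedF α γ {l} x = pFq {α, l + 1} {γ, l} x := by
  simp only [shiftedF, Multiset.map_singleton]
  rfl

/-- For `M = 1` the auxiliary polynomial is linear and there is one extra parameter. -/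
lemma negRoots_auxPoly_one {e : ℕ → ℂ} {a α : ℂ} (ha : a ≠ 0) (hα : α ≠ 0) (he : e 1 ≠ 0) :
    negRoots (auxPoly 1 e a α) = {α * (1 + 4 * a * e 0 / e 1)} := by
  have h : auxPoly 1 e a α = Polynomial.C (e 1 / (4 * a * α)) * Polynomial.X
      + Polynomial.C (e 0 + e 1 / (4 * a)) := by
    simp only [auxPoly, Finset.sum_range_succ, Finset.sum_range_zero, zero_add, poch_zero, poch_one,
      descPochhammer_zero, descPochhammer_one, Nat.choose_self, Nat.choose_zero_right, Nat.cast_one,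
      pow_zero, pow_one, mul_one, div_one, Polynomial.C_add]
    rw [show e 1 / (4 * a) * (1 / α) = e 1 / (4 * a * α) by field_simp]
    ring
  rw [negRoots, h, Polynomial.roots_C_mul_X_add_C _ (by simp [ha, hα, he]), Multiset.map_singleton]
  congr 1
  field_simp
  ring

lemma two_cpow_div_Gamma_mul_ampSum_one {e : ℕ → ℂ} {a : ℂ} (ha : a ≠ 0) (he : e 1 ≠ 0)
    (ν : ℂ) : (2 : ℂ) ^ (ν + 2) * (√Real.pi : ℂ) / Complex.Gamma a * ampSum 1 e a
      = (2 : ℂ) ^ ν * (√Real.pi : ℂ) / Complex.Gamma (a + 1)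
        * (e 1 * (1 + 4 * a * e 0 / e 1)) := by
  have h : (2 : ℂ) ^ (ν + 2) = 2 ^ ν * 4 := by
    rw [Complex.cpow_add _ _ two_ne_zero, show (2 : ℂ) ^ (2 : ℂ) = 4 by
      rw [Complex.cpow_ofNat]; norm_num]
  rw [div_eq_mul_inv _ (Complex.Gamma a),
    Complex.one_div_Gamma_eq_self_mul_one_div_Gamma_add_one a, h]
  simp only [ampSum, Finset.sum_range_succ, Finset.sum_range_zero, zero_add, poch_zero, poch_one,
    pow_zero, pow_one, mul_one, div_one]
  field_simp
  ring

lemma hermiteSum_zero_eq_explicit0 {p₀ p₁ q₁ s β : ℂ} {d : ℕ → ℂ} (hβ : β = p₀ + q₁ / 2)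
    (hd : d 0 = 1) (z : ℂ) :
    hermiteSum 0 p₀ p₁ q₁ s d z = explicit0 β (s * z - p₁ / 2) := by
  simp only [hermiteSum, ← hβ, explicit0, pref, hermiteH, zero_add, Finset.sum_range_one, hd,
    Nat.cast_zero, Nat.cast_one, add_zero, one_mul]

lemma hermiteSum_one_eq_explicit1 {p₀ p₁ q₁ s β : ℂ} {d : ℕ → ℂ} (hβ : β = p₀ + q₁ / 2) (z : ℂ) :
    hermiteSum 1 p₀ p₁ q₁ s d z = explicit1 β (s * z - p₁ / 2) (d 0) (d 1) := by
  simp only [hermiteSum, ← hβ, explicit1, pref, hermiteH, Finset.sum_range_succ,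
    Finset.sum_range_zero, zero_add, Nat.cast_zero, Nat.cast_one, Nat.cast_ofNat, add_zero]
  rw [show (1 : ℂ) / 2 - (β + 1) / 2 = -β / 2 by ring,
    show -(β + 1) / 2 = -β / 2 - 1 / 2 by ring, show β + 1 + 1 = β + 2 by ring]
  ring

lemma fourTerm_two_eq_explicit2 {β : ℂ} {d : ℕ → ℂ} (hβ : ∀ n : ℕ, 1 ≤ n → n ≤ 2 → β + n ≠ 0)
    (hd : d 0 = 1) (ξ : ℂ) :
    fourTerm 2 β d ξ = explicit2 β ξ (d 1)
      (1 + 4 * d 2 * (-β / 2 - 1 / 2)) (1 + 4 * d 2 * (-β / 2 - 1)) := by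
  have h1 : -β / 2 - 1 / 2 ≠ 0 := fun h => hβ 1 le_rfl (by norm_num)
    (by push_cast; linear_combination -2 * h)
  have h2 : -β / 2 - 1 ≠ 0 := fun h => hβ 2 (by norm_num) le_rfl
    (by push_cast; linear_combination -2 * h)
  have e0 : evenCoeff 2 d 0 = d 2 := rfl
  have e1 : evenCoeff 2 d 1 = 1 := hd
  have o0 : oddCoeff 2 d 0 = d 1 := rfl
  have he1 : evenCoeff 2 d 1 ≠ 0 := by rw [e1]; exact one_ne_zero
  have r1 := negRoots_auxPoly_one h1 h2 he1
  have r2 := negRoots_auxPoly_one h2 h1 he1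
  have a1 := two_cpow_div_Gamma_mul_ampSum_one h1 he1 β
  have a2 := two_cpow_div_Gamma_mul_ampSum_one h2 he1 (β + 1)
  rw [e0, e1, div_one, mul_right_comm 4] at r1 r2 a1 a2
  rw [show -β / 2 - 1 / 2 + 1 = -β / 2 + 1 / 2 by ring] at a1
  rw [show -β / 2 - 1 + 1 = -β / 2 by ring] at a2
  have w : (1 : ℂ) / 2 - β / 2 - 1 = -β / 2 - 1 / 2 := by ring
  simp only [fourTerm, ampC', ampD', ampC'', ampD'', lam', mu', lam'', mu'', polyG', polyH',
    polyG'', polyH'', show half' 2 = 1 from rfl, show half'' 2 = 0 from rfl, Nat.cast_one,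
    Nat.cast_zero, mul_one, mul_zero, sub_zero, add_zero, auxPoly_zero, negRoots_C, ampSum_zero,
    shiftedF_zero, w, r1, r2, a1, a2, shiftedF_singleton, o0, explicit2, pref, Nat.cast_ofNat]
  ring

lemma fourTerm_three_eq_explicit3 {β : ℂ} {d : ℕ → ℂ} (hβ : ∀ n : ℕ, 1 ≤ n → n ≤ 3 → β + n ≠ 0)
    (hd : d 0 ≠ 0) (hd1 : d 1 ≠ 0) (ξ : ℂ) :
    fourTerm 3 β d ξ = explicit3 β ξ (d 0) (d 1)
      (1 + 4 * (-β / 2 - 1 / 2) * d 2 / d 0) (1 + 4 * (-β / 2 - 1) * d 2 / d 0)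
      (1 + 4 * (-β / 2 - 1) * d 3 / d 1) (1 + 4 * (-β / 2 - 3 / 2) * d 3 / d 1) := by
  have h1 : -β / 2 - 1 / 2 ≠ 0 := fun h => hβ 1 le_rfl (by norm_num)
    (by push_cast; linear_combination -2 * h)
  have h2 : -β / 2 - 1 ≠ 0 := fun h => hβ 2 (by norm_num) (by norm_num)
    (by push_cast; linear_combination -2 * h)
  have h3 : -β / 2 - 3 / 2 ≠ 0 := fun h => hβ 3 (by norm_num) le_rfl
    (by push_cast; linear_combination -2 * h)
  have r1 := negRoots_auxPoly_one (e := evenCoeff 3 d) h1 h2 hd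
  have r2 := negRoots_auxPoly_one (e := evenCoeff 3 d) h2 h1 hd
  have r3 := negRoots_auxPoly_one (e := oddCoeff 3 d) h2 h3 hd1
  have r4 := negRoots_auxPoly_one (e := oddCoeff 3 d) h3 h2 hd1
  have a1 := two_cpow_div_Gamma_mul_ampSum_one (e := evenCoeff 3 d) h1 hd β
  have a2 := two_cpow_div_Gamma_mul_ampSum_one (e := evenCoeff 3 d) h2 hd (β + 1)
  have a3 := two_cpow_div_Gamma_mul_ampSum_one (e := oddCoeff 3 d) h2 hd1 (β + 1)
  have a4 := two_cpow_div_Gamma_mul_ampSum_one (e := oddCoeff 3 d) h3 hd1 (β + 2)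
  have e0 : evenCoeff 3 d 0 = d 2 := rfl
  have e1 : evenCoeff 3 d 1 = d 0 := rfl
  have o0 : oddCoeff 3 d 0 = d 3 := rfl
  have o1 : oddCoeff 3 d 1 = d 1 := rfl
  rw [e0, e1] at r1 r2 a1 a2
  rw [o0, o1] at r3 r4 a3 a4
  rw [show -β / 2 - 1 / 2 + 1 = -β / 2 + 1 / 2 by ring] at a1
  rw [show -β / 2 - 1 + 1 = -β / 2 by ring] at a2 a3
  rw [show -β / 2 - 3 / 2 + 1 = -β / 2 - 1 / 2 by ring] at a4
  have w : (1 : ℂ) / 2 - β / 2 - 1 = -β / 2 - 1 / 2 := by ring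
  have w' : -β / 2 - (1 : ℂ) / 2 - 1 = -β / 2 - 3 / 2 := by ring
  simp only [fourTerm, ampC', ampD', ampC'', ampD'', lam', mu', lam'', mu'', polyG', polyH',
    polyG'', polyH'', show half' 3 = 1 from rfl, show half'' 3 = 1 from rfl, Nat.cast_one,
    Nat.cast_zero, mul_one, add_zero, w, w', r1, r2, r3, r4, a1, a2, a3, a4, shiftedF_singleton,
    explicit3, pref, Nat.cast_ofNat]
  ring

end BiconfluentHeun

end

theorem mainTheorem1 (N : ℕ) (p₀ p₁ q₀ q₁ s β : ℂ)
    (hp₀ : p₀ = -(N : ℂ))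
    (hq₀ : Module.End.HasEigenvalue (BiconfluentHeun.hermiteMinor N p₁ q₁) q₀)
    (hβ : β = p₀ + q₁ / 2) :
    -- coefficients of a terminating Hermite-function expansion exist
    (∃ d : ℕ → ℂ, BiconfluentHeun.IsCoeffs N p₁ q₁ q₀ d) ∧
    ∀ d : ℕ → ℂ, BiconfluentHeun.IsCoeffs N p₁ q₁ q₀ d →
      -- the expansion is a nontrivial solution
      BiconfluentHeun.IsSolution p₀ p₁ q₀ q₁ s (BiconfluentHeun.hermiteSum N p₀ p₁ q₁ s d) ∧
      (s ≠ 0 → ∃ z, BiconfluentHeun.hermiteSum N p₀ p₁ q₁ s d z ≠ 0) ∧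
      ((∀ n : ℕ, 1 ≤ n → n ≤ N → β + n ≠ 0) →
        -- the numbers of extra parameters
        d 0 ≠ 0 ∧
        (BiconfluentHeun.lam' N β d).card = BiconfluentHeun.half' N ∧
        (BiconfluentHeun.mu' N β d).card = BiconfluentHeun.half' N ∧
        (d 1 ≠ 0 → (BiconfluentHeun.lam'' N β d).card = BiconfluentHeun.half'' N ∧
          (BiconfluentHeun.mu'' N β d).card = BiconfluentHeun.half'' N) ∧
        -- the solution in terms of four generalized hypergeometric functions
        (BiconfluentHeun.Admissible N β d →
          BiconfluentHeun.IsSolution p₀ p₁ q₀ q₁ s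
            (fun z => BiconfluentHeun.fourTerm N β d (s * z - p₁ / 2)) ∧
          ∀ z, BiconfluentHeun.hermiteSum N p₀ p₁ q₁ s d z =
            BiconfluentHeun.fourTerm N β d (s * z - p₁ / 2)) ∧
        -- the explicit cases
        (N = 0 → d 0 = 1 →
          ∀ z, BiconfluentHeun.hermiteSum N p₀ p₁ q₁ s d z =
            BiconfluentHeun.explicit0 β (s * z - p₁ / 2)) ∧
        (N = 1 → d 0 = 1 →
          d 1 = (p₁ + q₀) / (2 * (1 + β)) ∧
          ∀ z, BiconfluentHeun.hermiteSum N p₀ p₁ q₁ s d z =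
            BiconfluentHeun.explicit1 β (s * z - p₁ / 2) (d 0) (d 1)) ∧
        (N = 2 → d 0 = 1 →
          d 1 = (2 * p₁ + q₀) / (2 * (1 + β)) ∧
          d 2 = (2 + (p₁ + q₀) * d 1) / (4 * (2 + β)) ∧
          (BiconfluentHeun.Admissible N β d →
            ∀ z, BiconfluentHeun.hermiteSum N p₀ p₁ q₁ s d z =
              BiconfluentHeun.explicit2 β (s * z - p₁ / 2) (d 1)
                (1 + 4 * d 2 * (-β / 2 - 1 / 2)) (1 + 4 * d 2 * (-β / 2 - 1)))) ∧
        (N = 3 → d 0 = 1 →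
          d 1 = (3 * p₁ + q₀) / (2 * (1 + β)) ∧
          d 2 = (3 + (2 * p₁ + q₀) * d 1) / (4 * (2 + β)) ∧
          d 3 = (2 * d 1 + (p₁ + q₀) * d 2) / (6 * (3 + β)) ∧
          (d 1 ≠ 0 → BiconfluentHeun.Admissible N β d →
            ∀ z, BiconfluentHeun.hermiteSum N p₀ p₁ q₁ s d z =
              BiconfluentHeun.explicit3 β (s * z - p₁ / 2) (d 0) (d 1)
                (1 + 4 * (-β / 2 - 1 / 2) * d 2 / d 0) (1 + 4 * (-β / 2 - 1) * d 2 / d 0)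
                (1 + 4 * (-β / 2 - 1) * d 3 / d 1)
                (1 + 4 * (-β / 2 - 3 / 2) * d 3 / d 1)))) := by
  subst hp₀
  refine ⟨BiconfluentHeun.exists_isCoeffs hq₀, fun d hd =>
    ⟨BiconfluentHeun.isSolution_hermiteSum s hd,
      BiconfluentHeun.exists_hermiteSum_ne_zero _ hd, fun hβn => ?_⟩⟩
  have hd0 : d 0 ≠ 0 := hd.zero_ne_zero (by rw [← hβ]; exact hβn)
  have hfour : BiconfluentHeun.Admissible N β d → ∀ z,
      BiconfluentHeun.hermiteSum N (-(N : ℂ)) p₁ q₁ s d z =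
        BiconfluentHeun.fourTerm N β d (s * z - p₁ / 2) := fun hadm z => by
    rw [BiconfluentHeun.hermiteSum, ← hβ]
    exact BiconfluentHeun.sum_hermiteH_eq_fourTerm hβn hd.2 hadm _
  obtain ⟨hlam', hmu'⟩ := BiconfluentHeun.card_lam'_mu' hβn hd0
  refine ⟨hd0, hlam', hmu', BiconfluentHeun.card_lam''_mu'' hβn, fun hadm => ⟨?_, hfour hadm⟩,
    ?_, ?_, ?_, ?_⟩
  · rw [← funext (hfour hadm)]
    exact BiconfluentHeun.isSolution_hermiteSum s hd
  · rintro rfl h0 z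
    exact BiconfluentHeun.hermiteSum_zero_eq_explicit0 hβ h0 z
  · rintro rfl h0
    refine ⟨?_, fun z => BiconfluentHeun.hermiteSum_one_eq_explicit1 hβ z⟩
    have h1 := hβn 1 le_rfl le_rfl
    have r0 := hd.row_zero
    rw [h0] at r0
    push_cast at h1 r0 hβ
    rw [eq_div_iff (mul_ne_zero two_ne_zero (by rwa [add_comm])), hβ]
    linear_combination r0
  · rintro rfl h0
    have h1 := hβn 1 le_rfl (by norm_num)
    have h2 := hβn 2 (by norm_num) le_rfl
    have r0 := hd.row_zero
    have r1 := hd.row_succ (n := 0) (by norm_num)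
    rw [h0] at r0 r1
    push_cast at h1 h2 r0 r1 hβ
    norm_num at r1
    refine ⟨?_, ?_, fun hadm z => ?_⟩
    · rw [eq_div_iff (mul_ne_zero two_ne_zero (by rwa [add_comm])), hβ]
      linear_combination r0
    · rw [eq_div_iff (mul_ne_zero (by norm_num) (by rwa [add_comm])), hβ]
      linear_combination r1
    · rw [hfour hadm, BiconfluentHeun.fourTerm_two_eq_explicit2 hβn h0]
  · rintro rfl h0
    have h1 := hβn 1 le_rfl (by norm_num)
    have h2 := hβn 2 (by norm_num) (by norm_num)
    have h3 := hβn 3 (by norm_num) le_rfl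
    have r0 := hd.row_zero
    have r1 := hd.row_succ (n := 0) (by norm_num)
    have r2 := hd.row_succ (n := 1) (by norm_num)
    rw [h0] at r0 r1
    push_cast at h1 h2 h3 r0 r1 r2 hβ
    norm_num at r1 r2
    refine ⟨?_, ?_, ?_, fun hd1 hadm z => ?_⟩
    · rw [eq_div_iff (mul_ne_zero two_ne_zero (by rwa [add_comm])), hβ]
      linear_combination r0
    · rw [eq_div_iff (mul_ne_zero (by norm_num) (by rwa [add_comm])), hβ]
      linear_combination r1
    · rw [eq_div_iff (mul_ne_zero (by norm_num) (by rwa [add_comm])), hβ]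
      linear_combination r2
    · rw [hfour hadm, BiconfluentHeun.fourTerm_three_eq_explicit3 hβn hd0 hd1]
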